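/- Let $1\le n\le d$ be integers and let $W_0,W_1,\dots$ be independent random $d\times d$ matrices with i.i.d. entries $\mathcal N(0,1/d)$. For a deterministic input batch $H_0\in\mathbb R^{d\times n}$, $H_0\neq 0$, define the hidden representations of the linear network with batch normalization by $$H_{\ell+1}=\frac1{\sqrt d}\,BN(W_\ell H_\ell),\qquad BN(M)=\mathrm{diag}(MM^\top)^{-1/2}M,$$ where $\mathrm{diag}$ keeps only the diagonal entries. Let $\sigma_n(H)$ be the minimum ($n$-th largest) singular value of $H\in\mathbb R^{d\times n}$, and let $$V(H)=\Big\|\tfrac1{\|H\|_F^2}H^\top H-\tfrac1{\|I_n\|_F^2}I_n\Big\|_F$$ be its orthogonality gap. Let $\ell\ge 0$ and $\alpha>0$. Then $V(H_{\ell+1})$ is integrable, and: (a) If $\sigma_n(H_k)\ge\alpha$ for all $k=1,\dots,\ell$ almost surely, then $$\mathbb E\big[V(H_{\ell+1})\big]\le 2\Big(1-\frac23\alpha\Big)^{\ell}+\frac{3n}{\alpha\sqrt d}.$$ (b) Without any almost sure assumption, if $\alpha\le 1$ and $A_\ell$ denotes the event that $\sigma_n(H_k)^2\ge\alpha$ for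 all $k=1,\dots,\ell$, then $$\mathbb E\big[V(H_{\ell+1})\,\mathbf 1_{A_\ell}\big]\le 2\Big(1-\frac23\alpha\Big)^{\ell}+\frac{3n}{\alpha\sqrt d}.$$ (For $n\ge2$ and $\ell\ge1$ the almost sure assumption in (a) is never satisfied by Gaussian weights, so in that range (b) carries the content.) -/

import Mathlib

open MeasureTheory ProbabilityTheory
open scoped NNReal

/-- Batch normalization (without mean correction) `BN(M) = diag(M Mᵀ)^{-1/2} M`:
every row of `M` is divided by its Euclidean norm. -/
noncomputable def batchNorm {d n : ℕ} (M : Matrix (Fin d) (Fin n) ℝ) :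
    Matrix (Fin d) (Fin n) ℝ :=
  Matrix.diagonal (fun i => (Real.sqrt ((M * M.transpose) i i))⁻¹) * M

/-- The hidden representations of the linear network with batch normalization:
`H_0` is the input batch and `H_{ℓ+1} = (1/√d) BN(W_ℓ H_ℓ)`. -/
noncomputable def hiddenRep {d n : ℕ} (H₀ : Matrix (Fin d) (Fin n) ℝ)
    (W : ℕ → Matrix (Fin d) (Fin d) ℝ) : ℕ → Matrix (Fin d) (Fin n) ℝ
  | 0 => H₀
  | l + 1 => (1 / Real.sqrt d) • batchNorm (W l * hiddenRep H₀ W l)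

/-- The Frobenius norm of a real matrix. -/
noncomputable def frobNorm {m n : ℕ} (A : Matrix (Fin m) (Fin n) ℝ) : ℝ :=
  Real.sqrt (∑ i, ∑ j, A i j ^ 2)

/-- The orthogonality gap `V(H) = ‖ HᵀH / ‖H‖_F² - I_n / ‖I_n‖_F² ‖_F`. -/
noncomputable def orthogonalityGap {d n : ℕ} (H : Matrix (Fin d) (Fin n) ℝ) : ℝ :=
  frobNorm ((1 / frobNorm H ^ 2) • (H.transpose * H)
    - (1 / frobNorm (1 : Matrix (Fin n) (Fin n) ℝ) ^ 2) • (1 : Matrix (Fin n) (Fin n) ℝ))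

/-- The minimum singular value `σ_n(H)` of a `d × n` matrix with `1 ≤ n ≤ d`: the `n`-th largest
singular value (Mathlib numbers the singular values from `0`, in decreasing order). -/
noncomputable def minSingularValue {d n : ℕ} (H : Matrix (Fin d) (Fin n) ℝ) : ℝ :=
  (Matrix.toEuclideanLin H).singularValues (n - 1)

/-- The family `W_0, W_1, …` of random `d × d` matrices is independent with `W_ℓ ~ N(0, I_d/d)`:
all entries of all the matrices are jointly independent centred Gaussians of variance `1/d`. -/
structure IsGaussianWeights {Ω : Type*} [MeasurableSpace Ω] (P : Measure Ω) {d : ℕ}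
    (W : ℕ → Ω → Matrix (Fin d) (Fin d) ℝ) : Prop where
  hasLaw : ∀ l i j, HasLaw (fun ω => W l ω i j) (gaussianReal 0 ((d : ℝ≥0)⁻¹)) P
  indep : iIndepFun (fun (p : ℕ × Fin d × Fin d) (ω : Ω) => W p.1 ω p.2.1 p.2.2) P

/-! Conditionally on the past, one layer multiplies the gap by at most 1 - 2a/3, up to an additive
1/√d, whenever a > 0 bounds the squared singular values of the incoming H from below and ‖H‖_F ≤ 1
(`integral_orthogonalityGap_layer_le`). An orthogonal change of the columns diagonalizes HᵀH, and
batch normalization forgets the scale; so the rows of the product may be taken as independent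
Gaussian vectors y with independent coordinates, of variances q_j summing to 1. The new Gram matrix
is the average of d independent projections yyᵀ/‖y‖². It lies within 1/√d of its mean in expected
Frobenius norm, and the mean is diagonal by sign symmetry.

It remains to see that f_j = E[y_j²/‖y‖²] is closer to uniform than q. Writing 1/‖y‖² = ∫
exp(-t‖y‖²) dt over t > 0 gives f_j = ∫ w(t) g_j(t) dt, where g_j = q_j/(1 + 2tq_j) and w is the
Laplace transform of ‖y‖² (`integral_lineProj_self`). The deviation of g(t) from its mean, relative
to G = ∑ g_j, is at most 1/(1 + 2ta) times that of q (`tiltVar_deviation_le`). Since w' = -wG,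
averaging this factor is a one-dimensional problem, with answer at most 1 - 2a/3
(`integral_tiltWeight_div_le`).

Iterating over the decreasing events on which the past is well conditioned gives (b); the errors sum
geometrically to 3/(2a√d). In (a), the case ℓ = 0 is V ≤ 1. For ℓ ≥ 1 and n = 1 the gap vanishes
almost surely. For ℓ ≥ 1 and n ≥ 2 the assumption is contradictory, because Gaussian weights charge
every neighbourhood of a matrix that gives the first layer rank one
(`not_ae_le_minSingularValue_layer`). -/

/-! ### Equalization of the tilted variances and the averaged contraction factor -/

/-- The variances `q_j / (1 + 2 t q_j)` of the tilted Gaussian. -/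
noncomputable def tiltVar {n : ℕ} (q : Fin n → ℝ) (t : ℝ) (j : Fin n) : ℝ :=
  q j / (1 + 2 * t * q j)

/-- The Laplace transform of `∑ y_j²` for independent `y_j ~ N(0, q_j)`. -/
noncomputable def tiltWeight {n : ℕ} (q : Fin n → ℝ) (t : ℝ) : ℝ :=
  ∏ j, Real.exp (-(1 / 2) * Real.log (1 + 2 * t * q j))

lemma tiltVar_pos {n : ℕ} {q : Fin n → ℝ} (hq : ∀ j, 0 < q j) {t : ℝ} (ht : 0 ≤ t) (j : Fin n) :
    0 < tiltVar q t j := by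
  have := hq j
  unfold tiltVar
  positivity

lemma tiltWeight_pos {n : ℕ} (q : Fin n → ℝ) (t : ℝ) : 0 < tiltWeight q t :=
  Finset.prod_pos fun _ _ => Real.exp_pos _

lemma hasDerivAt_tiltVar {n : ℕ} {q : Fin n → ℝ} {t : ℝ} (j : Fin n)
    (h : 1 + 2 * t * q j ≠ 0) :
    HasDerivAt (fun t => tiltVar q t j) (-2 * tiltVar q t j ^ 2) t := by
  unfold tiltVar
  have h1 : HasDerivAt (fun t : ℝ => 1 + 2 * t * q j) (2 * q j) t := by
    have := (((hasDerivAt_id t).const_mul 2).mul_const (q j)).const_add 1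
    simpa using this
  refine ((hasDerivAt_const t (q j)).div h1 h).congr_deriv ?_
  field_simp
  ring

/-- The right side is G times ∑ g_j (g_j - S/G)², the variance of g under weights proportional to g.
Lowering each weight to m, and then replacing the centre S/G by the minimizer G/n of the unweighted
sum of squares, only decreases it. This is the differential inequality behind the decay of the
deviation. -/
lemma sum_cube_mul_sum_ge {n : ℕ} (g : Fin n → ℝ) {m : ℝ} (hm : 0 ≤ m) (hg : ∀ j, m ≤ g j)
    (hG : 0 < ∑ j, g j) :
    m * (∑ j, g j) * (∑ j, g j ^ 2 - (∑ j, g j) ^ 2 / n)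
      ≤ (∑ j, g j ^ 3) * (∑ j, g j) - (∑ j, g j ^ 2) ^ 2 := by
  have hn : (0 : ℝ) < n := by
    rcases Nat.eq_zero_or_pos n with rfl | h
    · simp at hG
    · exact_mod_cast h
  set G := ∑ j, g j with hGdef
  set S := ∑ j, g j ^ 2 with hS
  have h1 : ∑ j, m * (g j - S / G) ^ 2 ≤ ∑ j, g j * (g j - S / G) ^ 2 :=
    Finset.sum_le_sum fun j _ => mul_le_mul_of_nonneg_right (hg j) (sq_nonneg _)
  have h2 : ∑ j, m * (g j - S / G) ^ 2 = m * (S - 2 * (S / G) * G + n * (S / G) ^ 2) := by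
    have : ∀ j, (g j - S / G) ^ 2 = g j ^ 2 - 2 * (S / G) * g j + (S / G) ^ 2 := fun j => by ring
    rw [← Finset.mul_sum]
    simp only [this, Finset.sum_add_distrib, Finset.sum_sub_distrib, ← Finset.mul_sum]
    rw [← hS, ← hGdef]
    simp
  have h3 : ∑ j, g j * (g j - S / G) ^ 2 = ∑ j, g j ^ 3 - S ^ 2 / G := by
    have : ∀ j, g j * (g j - S / G) ^ 2
        = g j ^ 3 - 2 * (S / G) * g j ^ 2 + (S / G) ^ 2 * g j := fun j => by ring
    simp only [this, Finset.sum_add_distrib, Finset.sum_sub_distrib, ← Finset.mul_sum]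
    rw [← hS, ← hGdef]
    field_simp
    ring
  have h4 : m * (S - G ^ 2 / n) ≤ m * (S - 2 * (S / G) * G + n * (S / G) ^ 2) := by
    apply mul_le_mul_of_nonneg_left _ hm
    have : (0 : ℝ) ≤ n * (S / G - G / n) ^ 2 := by positivity
    have h5 : (n : ℝ) * (S / G - G / n) ^ 2 = n * (S / G) ^ 2 - 2 * (S / G) * G + G ^ 2 / n := by
      field_simp
      ring
    linarith
  have h6 : m * (S - G ^ 2 / n) ≤ ∑ j, g j ^ 3 - S ^ 2 / G := by linarith
  have h7 := mul_le_mul_of_nonneg_left h6 hG.le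
  have h8 : G * (∑ j, g j ^ 3 - S ^ 2 / G) = (∑ j, g j ^ 3) * G - S ^ 2 := by
    field_simp
  rw [h8] at h7
  linarith

/-- The tilted variances equalize: their relative deviation from the uniform vector decays at
least like `(1 + 2 t a)⁻¹`, where `a` is a lower bound of the initial ones. -/
lemma tiltVar_deviation_le {n : ℕ} (hn : 0 < n) {q : Fin n → ℝ} {a : ℝ} (ha : 0 < a)
    (hq : ∀ j, a ≤ q j) (hsum : ∑ j, q j = 1) {t : ℝ} (ht : 0 ≤ t) :
    (1 + 2 * t * a) ^ 2 * (∑ j, tiltVar q t j ^ 2 - (∑ j, tiltVar q t j) ^ 2 / n)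
      ≤ (∑ j, tiltVar q t j) ^ 2 * (∑ j, q j ^ 2 - 1 / n) := by
  have : NeZero n := ⟨hn.ne'⟩
  have hq0 : ∀ j, 0 < q j := fun j => ha.trans_le (hq j)
  have hGpos : ∀ s : ℝ, 0 ≤ s → 0 < ∑ j, tiltVar q s j := fun s hs =>
    Finset.sum_pos (fun j _ => tiltVar_pos hq0 hs j) Finset.univ_nonempty
  -- The squared relative deviation times the inverse of the expected decay rate: the claim is that
  -- F is antitone, compared at 0 and t.
  let F : ℝ → ℝ := fun s =>
    (1 + 2 * s * a) ^ 2 * ((∑ j, tiltVar q s j ^ 2) / (∑ j, tiltVar q s j) ^ 2 - 1 / n)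
  have hder : ∀ s : ℝ, 0 ≤ s → HasDerivAt F
      (4 * a * (1 + 2 * s * a) * ((∑ j, tiltVar q s j ^ 2) / (∑ j, tiltVar q s j) ^ 2 - 1 / n)
        + (1 + 2 * s * a) ^ 2 * (-4 * ((∑ j, tiltVar q s j ^ 3) * (∑ j, tiltVar q s j)
          - (∑ j, tiltVar q s j ^ 2) ^ 2) / (∑ j, tiltVar q s j) ^ 3)) s := by
    intro s hs
    have hne : ∀ j, 1 + 2 * s * q j ≠ 0 := fun j => by have := hq0 j; positivity
    have h1 : HasDerivAt (fun s : ℝ => (1 + 2 * s * a) ^ 2) (4 * a * (1 + 2 * s * a)) s := by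
      have := ((((hasDerivAt_id s).const_mul 2).mul_const a).const_add 1).pow 2
      refine this.congr_deriv ?_
      simp
      ring
    have h2 : HasDerivAt (fun s => ∑ j, tiltVar q s j ^ 2) (-4 * ∑ j, tiltVar q s j ^ 3) s := by
      have := HasDerivAt.fun_sum (u := Finset.univ)
        fun j (_ : j ∈ Finset.univ) => (hasDerivAt_tiltVar j (hne j)).pow 2
      refine this.congr_deriv ?_
      rw [Finset.mul_sum]
      refine Finset.sum_congr rfl fun j _ => ?_
      simp
      ring
    have h3 : HasDerivAt (fun s => ∑ j, tiltVar q s j) (-2 * ∑ j, tiltVar q s j ^ 2) s := by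
      have := HasDerivAt.fun_sum (u := Finset.univ)
        fun j (_ : j ∈ Finset.univ) => hasDerivAt_tiltVar j (hne j)
      refine this.congr_deriv ?_
      rw [Finset.mul_sum]
    have hG := hGpos s hs
    refine (h1.mul ((h2.div (h3.pow 2) (pow_ne_zero 2 hG.ne')).sub_const (1 / (n : ℝ)))).congr_deriv ?_
    simp only [Pi.div_apply, Pi.pow_apply]
    congr 2
    field_simp
    ring
  have hmono : AntitoneOn F (Set.Ici 0) := by
    apply antitoneOn_of_deriv_nonpos (convex_Ici 0)
    · exact fun s hs => (hder s hs).continuousAt.continuousWithinAt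
    · rw [interior_Ici]
      exact fun s hs => (hder s (le_of_lt hs)).differentiableAt.differentiableWithinAt
    · rw [interior_Ici]
      intro s hs
      have hs : (0 : ℝ) ≤ s := le_of_lt hs
      rw [(hder s hs).deriv]
      have hG := hGpos s hs
      -- The map x ↦ x/(1 + 2sx) is increasing, so the lower bound a is transported along the tilt.
      have hm : ∀ j, a / (1 + 2 * s * a) ≤ tiltVar q s j := by
        intro j
        have := hq0 j
        unfold tiltVar
        rw [div_le_div_iff₀ (by positivity) (by positivity)]
        nlinarith [hq j]
      have key := sum_cube_mul_sum_ge (fun j => tiltVar q s j) (by positivity) hm hG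
      set G := ∑ j, tiltVar q s j
      set S := ∑ j, tiltVar q s j ^ 2
      set C := ∑ j, tiltVar q s j ^ 3
      have hb : 0 < 1 + 2 * s * a := by positivity
      have e : 4 * a * (1 + 2 * s * a) * (S / G ^ 2 - 1 / n)
          + (1 + 2 * s * a) ^ 2 * (-4 * (C * G - S ^ 2) / G ^ 3)
          = 4 * (1 + 2 * s * a) ^ 2 / G ^ 3 *
            (a / (1 + 2 * s * a) * G * (S - G ^ 2 / n) - (C * G - S ^ 2)) := by
        have : (n : ℝ) ≠ 0 := by exact_mod_cast hn.ne'
        field_simp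
        ring
      rw [e]
      apply mul_nonpos_of_nonneg_of_nonpos (by positivity)
      linarith
  have h0 := hmono (Set.self_mem_Ici) (Set.mem_Ici.2 ht) ht
  have hF0 : F 0 = ∑ j, q j ^ 2 - 1 / n := by
    simp [F, tiltVar, hsum]
  rw [hF0] at h0
  have hG := hGpos t ht
  calc _ = (∑ j, tiltVar q t j) ^ 2 * F t := by
        simp only [F]
        field_simp
    _ ≤ _ := mul_le_mul_of_nonneg_left h0 (by positivity)

lemma hasDerivAt_tiltWeight {n : ℕ} {q : Fin n → ℝ} (hq : ∀ j, 0 < q j) {t : ℝ} (ht : 0 ≤ t) :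
    HasDerivAt (tiltWeight q) (-(tiltWeight q t * ∑ j, tiltVar q t j)) t := by
  have hw : tiltWeight q = fun t => Real.exp (∑ j, -(1 / 2) * Real.log (1 + 2 * t * q j)) := by
    funext t
    rw [Real.exp_sum, tiltWeight]
  have h1 : HasDerivAt (fun t => ∑ j, -(1 / 2) * Real.log (1 + 2 * t * q j))
      (∑ j, -tiltVar q t j) t := by
    refine HasDerivAt.fun_sum fun j _ => ?_
    have hne : 1 + 2 * t * q j ≠ 0 := by have := hq j; positivity
    have := ((((hasDerivAt_id t).const_mul 2).mul_const (q j)).const_add 1).log hne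
    refine (this.const_mul (-(1 / 2))).congr_deriv ?_
    simp [tiltVar]
    field_simp
  rw [hw]
  refine h1.exp.congr_deriv ?_
  simp [Finset.sum_neg_distrib]

/-- This is Jensen's inequality for the Laplace transform of a variable of mean 1, read off from
log(1 + x) ≤ x. -/
lemma exp_neg_le_tiltWeight {n : ℕ} {q : Fin n → ℝ} (hq : ∀ j, 0 < q j) (hsum : ∑ j, q j = 1)
    {t : ℝ} (ht : 0 ≤ t) : Real.exp (-t) ≤ tiltWeight q t := by
  rw [tiltWeight, ← Real.exp_sum]
  apply Real.exp_le_exp.2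
  have : -t = ∑ j, -(1 / 2) * (2 * t * q j) := by
    have : ∀ j, -(1 / 2) * (2 * t * q j) = -t * q j := fun j => by ring
    simp only [this, ← Finset.mul_sum, hsum, mul_one]
  rw [this]
  refine Finset.sum_le_sum fun j _ => ?_
  have h0 := hq j
  have := Real.log_le_sub_one_of_pos (show 0 < 1 + 2 * t * q j by positivity)
  linarith

lemma tendsto_tiltWeight_atTop {n : ℕ} (hn : 0 < n) {q : Fin n → ℝ} (hq : ∀ j, 0 < q j) :
    Filter.Tendsto (tiltWeight q) Filter.atTop (nhds 0) := by
  have hlim : ∀ j, Filter.Tendsto (fun t => Real.exp (-(1 / 2) * Real.log (1 + 2 * t * q j)))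
      Filter.atTop (nhds 0) := by
    intro j
    refine Real.tendsto_exp_atBot.comp ?_
    refine Filter.Tendsto.const_mul_atTop_of_neg (by norm_num) (Real.tendsto_log_atTop.comp ?_)
    refine Filter.tendsto_atTop_add_const_left _ _ ?_
    exact (Filter.tendsto_id.const_mul_atTop two_pos).atTop_mul_const (hq j)
  have := tendsto_finsetProd (Finset.univ : Finset (Fin n)) fun j _ => hlim j
  rw [Finset.prod_const, Finset.card_univ, Fintype.card_fin, zero_pow hn.ne'] at this
  exact this

/-- The averaged contraction factor. -/
lemma integral_tiltWeight_div_le {n : ℕ} (hn : 0 < n) {q : Fin n → ℝ} {a : ℝ} (ha : 0 < a)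
    (ha2 : a ≤ 1 / 2) (hq : ∀ j, a ≤ q j) (hsum : ∑ j, q j = 1) :
    IntegrableOn (fun t => tiltWeight q t * (∑ j, tiltVar q t j) / (1 + 2 * t * a)) (Set.Ioi 0) ∧
    ∫ t in Set.Ioi 0, tiltWeight q t * (∑ j, tiltVar q t j) / (1 + 2 * t * a) ≤ 1 - 2 / 3 * a := by
  have hq0 : ∀ j, 0 < q j := fun j => ha.trans_le (hq j)
  -- Integration by parts turns the integral into 1 - 2a ∫ w/(1 + 2ta)², and w ≥ exp(-t). The second
  -- term of K bounds ∫ exp(-t)/(1 + 2ta)² below by 1/3: minus the derivative of this integrand's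
  -- own formula is at most three times it when 2a ≤ 1. Thus -K' dominates the integrand, and K
  -- falls from 1 - 2a/3 to 0.
  let K : ℝ → ℝ := fun t => tiltWeight q t / (1 + 2 * t * a)
    - 2 / 3 * a * (Real.exp (-t) / (1 + 2 * t * a) ^ 2)
  let K' : ℝ → ℝ := fun t => -(tiltWeight q t * (∑ j, tiltVar q t j) / (1 + 2 * t * a))
    - 2 * a * tiltWeight q t / (1 + 2 * t * a) ^ 2
    + 2 / 3 * a * (Real.exp (-t) / (1 + 2 * t * a) ^ 2
      + 4 * a * Real.exp (-t) / (1 + 2 * t * a) ^ 3)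
  have hK : ∀ t : ℝ, 0 ≤ t → HasDerivAt K (K' t) t := by
    intro t ht
    have hb : 1 + 2 * t * a ≠ 0 := by positivity
    have h1 : HasDerivAt (fun t : ℝ => 1 + 2 * t * a) (2 * a) t := by
      have := (((hasDerivAt_id t).const_mul 2).mul_const a).const_add 1
      simpa using this
    have h2 : HasDerivAt (fun t : ℝ => Real.exp (-t)) (-Real.exp (-t)) t := by
      simpa using (hasDerivAt_neg t).exp
    refine (((hasDerivAt_tiltWeight hq0 ht).div h1 hb).sub
      ((h2.div (h1.pow 2) (pow_ne_zero 2 hb)).const_mul (2 / 3 * a))).congr_deriv ?_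
    simp only [K', Pi.pow_apply]
    field_simp
    ring
  have hle : ∀ t : ℝ, 0 ≤ t →
      tiltWeight q t * (∑ j, tiltVar q t j) / (1 + 2 * t * a) ≤ -K' t := by
    intro t ht
    have hb : 0 < 1 + 2 * t * a := by positivity
    have hw := exp_neg_le_tiltWeight hq0 hsum ht
    have h1 : 4 * a * Real.exp (-t) / (1 + 2 * t * a) ^ 3
        ≤ 2 * (Real.exp (-t) / (1 + 2 * t * a) ^ 2) := by
      rw [mul_div_assoc', div_le_div_iff₀ (by positivity) (by positivity)]
      have : 0 < Real.exp (-t) * (1 + 2 * t * a) ^ 2 := by positivity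
      have h3 : 2 * a ≤ 1 + 2 * t * a := by nlinarith
      nlinarith [mul_le_mul_of_nonneg_left h3 this.le]
    have h2 : Real.exp (-t) / (1 + 2 * t * a) ^ 2 ≤ tiltWeight q t / (1 + 2 * t * a) ^ 2 := by
      gcongr
    simp only [K']
    have e : 2 * a * tiltWeight q t / (1 + 2 * t * a) ^ 2
        = 2 * a * (tiltWeight q t / (1 + 2 * t * a) ^ 2) := by ring
    rw [e]
    have h3 := mul_le_mul_of_nonneg_left h1 (show 0 ≤ 2 / 3 * a by positivity)
    have h4 := mul_le_mul_of_nonneg_left h2 (show 0 ≤ 2 * a by positivity)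
    linarith
  have hnn : ∀ t : ℝ, 0 ≤ t →
      0 ≤ tiltWeight q t * (∑ j, tiltVar q t j) / (1 + 2 * t * a) := fun t ht => by
    have := tiltWeight_pos q t
    have := Finset.sum_nonneg fun j (_ : j ∈ Finset.univ) => (tiltVar_pos hq0 ht j).le
    positivity
  have hneg : ∀ t ∈ Set.Ioi (0 : ℝ), K' t ≤ 0 := fun t ht => by
    linarith [hle t (le_of_lt ht), hnn t (le_of_lt ht)]
  have htop : Filter.Tendsto K Filter.atTop (nhds 0) := by
    have hb : Filter.Tendsto (fun t : ℝ => 1 + 2 * t * a) Filter.atTop Filter.atTop :=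
      Filter.tendsto_atTop_add_const_left _ _
        ((Filter.tendsto_id.const_mul_atTop two_pos).atTop_mul_const ha)
    have h1 := (tendsto_tiltWeight_atTop hn hq0).div_atTop hb
    have h2 := (Real.tendsto_exp_neg_atTop_nhds_zero.div_atTop
      ((Filter.tendsto_pow_atTop two_ne_zero).comp hb)).const_mul (2 / 3 * a)
    simpa [K] using h1.sub h2
  have hcont : ContinuousWithinAt K (Set.Ici 0) 0 :=
    (hK 0 le_rfl).continuousAt.continuousWithinAt
  have hint := integrableOn_Ioi_deriv_of_nonpos hcont (fun t ht => hK t (le_of_lt ht)) hneg htop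
  have hval := integral_Ioi_of_hasDerivAt_of_nonpos hcont (fun t ht => hK t (le_of_lt ht)) hneg htop
  have hK0 : K 0 = 1 - 2 / 3 * a := by simp [K, tiltWeight]
  have hmeas : AEStronglyMeasurable
      (fun t => tiltWeight q t * (∑ j, tiltVar q t j) / (1 + 2 * t * a))
      (volume.restrict (Set.Ioi 0)) := by
    refine Measurable.aestronglyMeasurable ?_
    unfold tiltWeight tiltVar
    fun_prop
  have hint' : IntegrableOn
      (fun t => tiltWeight q t * (∑ j, tiltVar q t j) / (1 + 2 * t * a)) (Set.Ioi 0) := by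
    refine Integrable.mono' hint.neg hmeas ?_
    filter_upwards [ae_restrict_mem measurableSet_Ioi] with t ht
    rw [Real.norm_of_nonneg (hnn t (le_of_lt ht))]
    exact hle t (le_of_lt ht)
  refine ⟨hint', ?_⟩
  calc _ ≤ ∫ t in Set.Ioi 0, -K' t :=
        setIntegral_mono_on hint' hint.neg measurableSet_Ioi fun t ht => hle t (le_of_lt ht)
    _ = _ := by rw [integral_neg, hval, hK0]; ring

/-! ### Gaussian tilting and the mean projection -/

/-- Completing the exponent: 1/(2v) + t = (1 + 2tv)/(2v), and the ratio of the normalizing constants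
is (1 + 2tv)^(-1/2), written through `Real.log` so that products over coordinates become
exponentials of sums. -/
lemma integral_mul_exp_neg_sq_gaussianReal {v : ℝ} (hv : 0 < v) {t : ℝ} (ht : 0 ≤ t) (f : ℝ → ℝ) :
    ∫ y, f y * Real.exp (-t * y ^ 2) ∂gaussianReal 0 v.toNNReal
      = Real.exp (-(1 / 2) * Real.log (1 + 2 * t * v))
        * ∫ y, f y ∂gaussianReal 0 (v / (1 + 2 * t * v)).toNNReal := by
  have hb : 0 < 1 + 2 * t * v := by positivity
  have hv' : 0 < v / (1 + 2 * t * v) := by positivity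
  rw [integral_gaussianReal_eq_integral_smul (by simpa using hv),
    integral_gaussianReal_eq_integral_smul (by simpa using hv'), ← integral_const_mul]
  refine integral_congr_ae (Filter.Eventually.of_forall fun y => ?_)
  have hexp : Real.exp (-(1 / 2) * Real.log (1 + 2 * t * v)) = (Real.sqrt (1 + 2 * t * v))⁻¹ := by
    rw [Real.sqrt_eq_rpow, ← Real.rpow_neg hb.le, Real.rpow_def_of_pos hb]
    ring_nf
  simp only [gaussianPDFReal, Real.coe_toNNReal _ hv.le, Real.coe_toNNReal _ hv'.le, smul_eq_mul,
    sub_zero, hexp]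
  have h1 : Real.sqrt (2 * Real.pi * (v / (1 + 2 * t * v)))
      = Real.sqrt (2 * Real.pi * v) / Real.sqrt (1 + 2 * t * v) := by
    rw [← Real.sqrt_div' _ hb.le]
    ring_nf
  have h2 : Real.exp (-y ^ 2 / (2 * (v / (1 + 2 * t * v))))
      = Real.exp (-y ^ 2 / (2 * v)) * Real.exp (-t * y ^ 2) := by
    rw [← Real.exp_add]
    congr 1
    field_simp
    ring
  have h3 : Real.sqrt (1 + 2 * t * v) ≠ 0 := (Real.sqrt_pos.2 hb).ne'
  rw [h1, h2]
  field_simp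

lemma integral_sq_gaussianReal (v : ℝ≥0) : ∫ y, y ^ 2 ∂gaussianReal 0 v = v := by
  rw [← variance_fun_id_gaussianReal (μ := 0), variance_of_integral_eq_zero (by fun_prop)]
  exact integral_id_gaussianReal

/-- The product of the centred Gaussian laws with variances `q_j`. -/
noncomputable def gaussianPi {n : ℕ} (q : Fin n → ℝ) : Measure (Fin n → ℝ) :=
  Measure.pi fun j => gaussianReal 0 (q j).toNNReal

instance {n : ℕ} (q : Fin n → ℝ) : IsProbabilityMeasure (gaussianPi q) := by
  unfold gaussianPi
  infer_instance

/-- The entries `y_j y_k / ‖y‖²` of the orthogonal projection onto the line of `y`. -/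
noncomputable def lineProj {n : ℕ} (y : Fin n → ℝ) (j k : Fin n) : ℝ :=
  y j * y k / ∑ l, y l ^ 2

@[fun_prop]
lemma measurable_lineProj {n : ℕ} (j k : Fin n) : Measurable fun y => lineProj y j k := by
  unfold lineProj
  fun_prop

lemma sum_sq_lineProj_le {n : ℕ} (y : Fin n → ℝ) : ∑ j, ∑ k, lineProj y j k ^ 2 ≤ 1 := by
  have h : ∑ j, ∑ k, lineProj y j k ^ 2 = (∑ l, y l ^ 2) ^ 2 / (∑ l, y l ^ 2) ^ 2 := by
    simp only [lineProj, div_pow, mul_pow, ← Finset.sum_div, ← Finset.mul_sum, ← Finset.sum_mul]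
    rw [sq (∑ l, y l ^ 2)]
  rw [h]
  exact div_self_le_one _

lemma abs_lineProj_le {n : ℕ} (y : Fin n → ℝ) (j k : Fin n) : |lineProj y j k| ≤ 1 := by
  rw [← sq_le_one_iff_abs_le_one]
  refine le_trans ?_ (sum_sq_lineProj_le y)
  exact (Finset.single_le_sum (f := fun k => lineProj y j k ^ 2) (fun _ _ => sq_nonneg _)
    (Finset.mem_univ k)).trans (Finset.single_le_sum (f := fun j => ∑ k, lineProj y j k ^ 2)
      (fun _ _ => Finset.sum_nonneg fun _ _ => sq_nonneg _) (Finset.mem_univ j))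

lemma integrable_lineProj {n : ℕ} (μ : Measure (Fin n → ℝ)) [IsFiniteMeasure μ] (j k : Fin n) :
    Integrable (fun y => lineProj y j k) μ :=
  Integrable.of_bound (measurable_lineProj j k).aestronglyMeasurable 1
    (Filter.Eventually.of_forall fun y => abs_lineProj_le y j k)

lemma ae_gaussianPi_sum_sq_pos {n : ℕ} (hn : 0 < n) {q : Fin n → ℝ} (hq : ∀ j, 0 < q j) :
    ∀ᵐ y ∂gaussianPi q, 0 < ∑ l, y l ^ 2 := by
  have h0 : ∀ᵐ x ∂gaussianReal 0 (q ⟨0, hn⟩).toNNReal, x ≠ 0 := by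
    have := nullSingletonClass_gaussianReal (μ := 0)
      (show (q ⟨0, hn⟩).toNNReal ≠ 0 by simpa using hq _)
    simp [ae_iff]
  have h1 := (measurePreserving_eval (fun j => gaussianReal 0 (q j).toNNReal)
    ⟨0, hn⟩).quasiMeasurePreserving.ae h0
  filter_upwards [h1] with y hy
  exact (by positivity : 0 < y ⟨0, hn⟩ ^ 2).trans_le
    (Finset.single_le_sum (f := fun l => y l ^ 2) (fun _ _ => sq_nonneg _) (Finset.mem_univ _))

lemma integral_sq_mul_exp_gaussianPi {n : ℕ} {q : Fin n → ℝ} (hq : ∀ j, 0 < q j) {t : ℝ}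
    (ht : 0 ≤ t) (j : Fin n) :
    ∫ y, y j ^ 2 * Real.exp (-t * ∑ l, y l ^ 2) ∂gaussianPi q
      = tiltWeight q t * tiltVar q t j := by
  have h1 : ∀ y : Fin n → ℝ, y j ^ 2 * Real.exp (-t * ∑ l, y l ^ 2)
      = ∏ l, ((if l = j then y l ^ 2 else 1) * Real.exp (-t * y l ^ 2)) := by
    intro y
    rw [Finset.prod_mul_distrib, Finset.prod_ite_eq' Finset.univ j, ← Real.exp_sum, Finset.mul_sum]
    simp
  simp only [h1, gaussianPi]
  rw [integral_fintype_prod_eq_prod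
    (f := fun l x => (if l = j then x ^ 2 else 1) * Real.exp (-t * x ^ 2))]
  have h2 : ∀ l, ∫ x, (if l = j then x ^ 2 else 1) * Real.exp (-t * x ^ 2)
        ∂gaussianReal 0 (q l).toNNReal
      = Real.exp (-(1 / 2) * Real.log (1 + 2 * t * q l))
        * (if l = j then tiltVar q t l else 1) := by
    intro l
    have := hq l
    rw [integral_mul_exp_neg_sq_gaussianReal (hq l) ht]
    congr 1
    split_ifs
    · rw [integral_sq_gaussianReal, Real.coe_toNNReal _ (by positivity), tiltVar]
    · simp
  simp only [h2]
  rw [Finset.prod_mul_distrib, Finset.prod_ite_eq' Finset.univ j, tiltWeight]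
  simp

/-- Fubini applied to 1/‖y‖² = ∫ exp(-t‖y‖²) dt, valid for almost every y. It replaces the ratio
y_j²/‖y‖² by integrands that factor over the coordinates. -/
lemma integral_lineProj_self {n : ℕ} (hn : 0 < n) {q : Fin n → ℝ} (hq : ∀ j, 0 < q j)
    (j : Fin n) :
    IntegrableOn (fun t => tiltWeight q t * tiltVar q t j) (Set.Ioi 0) ∧
    ∫ t in Set.Ioi 0, tiltWeight q t * tiltVar q t j = ∫ y, lineProj y j j ∂gaussianPi q := by
  let F : ℝ → (Fin n → ℝ) → ℝ := fun t y => y j ^ 2 * Real.exp (-t * ∑ l, y l ^ 2)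
  have hFnn : ∀ t y, 0 ≤ F t y := fun t y => by positivity
  have hval : ∀ᵐ y ∂gaussianPi q, ∫ t in Set.Ioi 0, F t y = lineProj y j j := by
    filter_upwards [ae_gaussianPi_sum_sq_pos hn hq] with y hy
    have h := integral_exp_mul_Ioi (neg_lt_zero.2 hy) 0
    simp only [F]
    rw [integral_const_mul]
    have : ∀ t : ℝ, -t * ∑ l, y l ^ 2 = (-∑ l, y l ^ 2) * t := fun t => by ring
    simp only [this, h, lineProj]
    simp
    ring
  have hint : Integrable (Function.uncurry F)
      ((volume.restrict (Set.Ioi 0)).prod (gaussianPi q)) := by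
    rw [integrable_prod_iff' (by
      refine Measurable.aestronglyMeasurable ?_
      simp only [F, Function.uncurry_def]
      fun_prop)]
    constructor
    · filter_upwards [ae_gaussianPi_sum_sq_pos hn hq] with y hy
      have h := integrableOn_exp_mul_Ioi (neg_lt_zero.2 hy) 0
      refine (h.const_mul (y j ^ 2)).congr (Filter.Eventually.of_forall fun t => ?_)
      simp only [Function.uncurry, F]
      ring_nf
    · refine (integrable_lineProj (gaussianPi q) j j).congr ?_
      filter_upwards [hval] with y hy
      rw [← hy]
      refine integral_congr_ae (Filter.Eventually.of_forall fun t => ?_)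
      exact (Real.norm_of_nonneg (hFnn t y)).symm
  have hae : ∀ᵐ t ∂volume.restrict (Set.Ioi (0 : ℝ)),
      ∫ y, F t y ∂gaussianPi q = tiltWeight q t * tiltVar q t j := by
    filter_upwards [ae_restrict_mem measurableSet_Ioi] with t ht
    exact integral_sq_mul_exp_gaussianPi hq (le_of_lt ht) j
  refine ⟨hint.integral_prod_left.congr hae, ?_⟩
  rw [← integral_congr_ae hae, integral_integral_swap hint]
  exact integral_congr_ae hval

/-- Flipping the sign of the j-th coordinate preserves the law and negates the integrand. -/
lemma integral_lineProj_of_ne {n : ℕ} (q : Fin n → ℝ) {j k : Fin n} (hjk : j ≠ k) :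
    ∫ y, lineProj y j k ∂gaussianPi q = 0 := by
  let φ : Fin n → ℝ → ℝ := fun i x => if i = j then -x else x
  have hφ : MeasurePreserving (fun (y : Fin n → ℝ) i => φ i (y i)) (gaussianPi q)
      (gaussianPi q) := by
    refine measurePreserving_pi _ _ fun i => ?_
    by_cases h : i = j
    · refine ⟨by simp only [φ, h, if_true]; fun_prop, ?_⟩
      simp only [φ, h, if_true]
      simpa using gaussianReal_map_neg (μ := 0) (v := (q j).toNNReal)
    · simp only [φ, h, if_false]
      exact MeasurePreserving.id _
  have h1 : ∫ y, lineProj y j k ∂gaussianPi q = ∫ y, -lineProj y j k ∂gaussianPi q := by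
    conv_lhs => rw [← hφ.map_eq]
    rw [integral_map hφ.aemeasurable (measurable_lineProj j k).aestronglyMeasurable]
    refine integral_congr_ae (Filter.Eventually.of_forall fun y => ?_)
    have h2 : ∀ l, φ l (y l) ^ 2 = y l ^ 2 := fun l => by
      simp only [φ]; split_ifs <;> ring
    simp only [lineProj, h2]
    simp only [φ, if_true, hjk.symm, if_false]
    ring
  rw [integral_neg] at h1
  linarith

/-- The expected projection onto the line of a Gaussian vector with independent coordinates is
closer to isotropic than the covariance. -/
lemma sum_sq_integral_lineProj_sub_le {n : ℕ} (hn : 0 < n) {q : Fin n → ℝ} {a : ℝ} (ha : 0 < a)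
    (hq : ∀ j, a ≤ q j) (hsum : ∑ j, q j = 1) :
    Real.sqrt (∑ j, (∫ y, lineProj y j j ∂gaussianPi q - 1 / n) ^ 2)
      ≤ (1 - 2 / 3 * a) * Real.sqrt (∑ j, (q j - 1 / n) ^ 2) := by
  have hq0 : ∀ j, 0 < q j := fun j => ha.trans_le (hq j)
  have hnR : (n : ℝ) ≠ 0 := by exact_mod_cast hn.ne'
  set f : Fin n → ℝ := fun j => ∫ y, lineProj y j j ∂gaussianPi q with hf
  have hfsum : ∑ j, f j = 1 := by
    rw [hf, ← integral_finsetSum _ fun j _ => integrable_lineProj _ j j]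
    rw [integral_congr_ae (g := fun _ => (1 : ℝ))]
    · simp
    filter_upwards [ae_gaussianPi_sum_sq_pos hn hq0] with y hy
    simp only [lineProj, ← Finset.sum_div, ← sq]
    exact div_self hy.ne'
  have hvar : ∀ g : Fin n → ℝ, ∑ j, (g j - (∑ i, g i) / n) ^ 2
      = ∑ j, g j ^ 2 - (∑ j, g j) ^ 2 / n := by
    intro g
    have : ∀ j, (g j - (∑ i, g i) / n) ^ 2
      = g j ^ 2 - 2 * ((∑ i, g i) / n) * g j + ((∑ i, g i) / n) ^ 2 := fun j => by ring
    simp only [this, Finset.sum_add_distrib, Finset.sum_sub_distrib, ← Finset.mul_sum]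
    simp
    field_simp
    ring
  -- For n = 1 both deviations are zero; for n ≥ 2 the unit sum forces a ≤ 1/2, as the scalar
  -- integral bound requires.
  rcases Nat.lt_or_ge 1 n with h2 | h1
  swap
  · obtain rfl : n = 1 := by omega
    have hf1 : f 0 = 1 := by simpa using hfsum
    have hq1 : q 0 = 1 := by simpa using hsum
    simp only [hf] at hf1
    simp [hf1, hq1]
  have ha2 : a ≤ 1 / 2 := by
    have h3 : ∑ _j : Fin n, a ≤ ∑ j, q j := Finset.sum_le_sum fun j _ => hq j
    rw [hsum] at h3
    simp at h3
    have : (2 : ℝ) ≤ n := by exact_mod_cast h2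
    nlinarith
  obtain ⟨hI, hIle⟩ := integral_tiltWeight_div_le hn ha ha2 hq hsum
  -- Duality: pairing f with its own deviation v gives N², and Cauchy–Schwarz under the t-integral
  -- gives N² ≤ N·D·(1 - 2a/3).
  set v : Fin n → ℝ := fun j => f j - 1 / n with hv
  set N := Real.sqrt (∑ j, v j ^ 2) with hN
  set D := Real.sqrt (∑ j, (q j - 1 / n) ^ 2) with hD
  have hvsum : ∑ j, v j = 0 := by
    simp [hv, Finset.sum_sub_distrib, hfsum, hnR]
  have hint : ∀ j, IntegrableOn (fun t => v j * (tiltWeight q t * tiltVar q t j)) (Set.Ioi 0) :=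
    fun j => (integral_lineProj_self hn hq0 j).1.const_mul _
  have hNN : N ^ 2 = ∫ t in Set.Ioi 0, ∑ j, v j * (tiltWeight q t * tiltVar q t j) := by
    rw [integral_finsetSum _ fun j _ => hint j, hN,
      Real.sq_sqrt (Finset.sum_nonneg fun _ _ => sq_nonneg _)]
    have h3 : ∀ j, ∫ t in Set.Ioi 0, v j * (tiltWeight q t * tiltVar q t j) = v j * f j := by
      intro j
      rw [integral_const_mul, (integral_lineProj_self hn hq0 j).2]
    simp only [h3]
    have h4 : ∀ j, v j ^ 2 = v j * f j - v j * (1 / n) := fun j => by simp only [hv]; ring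
    simp only [h4, Finset.sum_sub_distrib, ← Finset.sum_mul, hvsum]
    ring
  have hpt : ∀ t ∈ Set.Ioi (0 : ℝ), ∑ j, v j * (tiltWeight q t * tiltVar q t j)
      ≤ N * D * (tiltWeight q t * (∑ j, tiltVar q t j) / (1 + 2 * t * a)) := by
    intro t ht
    have ht0 : (0 : ℝ) ≤ t := le_of_lt ht
    have hb : 0 < 1 + 2 * t * a := by positivity
    set G := ∑ j, tiltVar q t j with hG
    have hG0 : 0 ≤ G := Finset.sum_nonneg fun j _ => (tiltVar_pos hq0 ht0 j).le
    -- Since v sums to zero, the mean G/n can be subtracted for free.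
    have h3 : ∑ j, v j * (tiltWeight q t * tiltVar q t j)
        = tiltWeight q t * ∑ j, v j * (tiltVar q t j - G / n) := by
      simp only [mul_sub, Finset.sum_sub_distrib, ← Finset.sum_mul, hvsum]
      rw [zero_mul, mul_zero, sub_zero, Finset.mul_sum]
      exact Finset.sum_congr rfl fun j _ => by ring
    have h4 : ∑ j, v j * (tiltVar q t j - G / n)
        ≤ N * Real.sqrt (∑ j, (tiltVar q t j - G / n) ^ 2) :=
      Real.sum_mul_le_sqrt_mul_sqrt _ _ _
    have h5 : Real.sqrt (∑ j, (tiltVar q t j - G / n) ^ 2) ≤ G * D / (1 + 2 * t * a) := by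
      apply Real.sqrt_le_iff.2
      refine ⟨by positivity, ?_⟩
      rw [div_pow, le_div_iff₀ (by positivity), mul_pow, hD,
        Real.sq_sqrt (Finset.sum_nonneg fun _ _ => sq_nonneg _), hG, hvar]
      have h6 := tiltVar_deviation_le hn ha hq hsum ht0
      have h7 := hvar q
      rw [hsum] at h7
      rw [h7, one_pow]
      linarith
    rw [h3]
    have h8 : 0 ≤ N := Real.sqrt_nonneg _
    calc _ ≤ tiltWeight q t * (N * (G * D / (1 + 2 * t * a))) :=
          mul_le_mul_of_nonneg_left (h4.trans (mul_le_mul_of_nonneg_left h5 h8))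
            (tiltWeight_pos q t).le
      _ = _ := by ring
  have hfin : N ^ 2 ≤ N * D * (1 - 2 / 3 * a) := by
    rw [hNN]
    calc _ ≤ ∫ t in Set.Ioi 0, N * D * (tiltWeight q t * (∑ j, tiltVar q t j) / (1 + 2 * t * a)) :=
          setIntegral_mono_on (integrable_finsetSum _ fun j _ => hint j) (hI.const_mul _)
            measurableSet_Ioi hpt
      _ ≤ _ := by
          rw [integral_const_mul]
          exact mul_le_mul_of_nonneg_left hIle
            (mul_nonneg (Real.sqrt_nonneg _) (Real.sqrt_nonneg _))
  rcases (Real.sqrt_nonneg (∑ j, v j ^ 2)).eq_or_lt with h0 | hpos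
  · rw [← hN] at h0
    rw [← h0]
    have : 0 ≤ D := Real.sqrt_nonneg _
    exact mul_nonneg (by linarith) this
  · rw [← hN] at hpos
    have : N * N ≤ N * ((1 - 2 / 3 * a) * D) := by nlinarith
    exact le_of_mul_le_mul_left this hpos

/-! ### Frobenius norm, and batch normalization as an average of line projections -/

section FrobeniusNorm

lemma frobNorm_nonneg {m n : ℕ} (A : Matrix (Fin m) (Fin n) ℝ) : 0 ≤ frobNorm A :=
  Real.sqrt_nonneg _

lemma frobNorm_sq {m n : ℕ} (A : Matrix (Fin m) (Fin n) ℝ) :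
    frobNorm A ^ 2 = ∑ i, ∑ j, A i j ^ 2 :=
  Real.sq_sqrt (Finset.sum_nonneg fun _ _ => Finset.sum_nonneg fun _ _ => sq_nonneg _)

lemma frobNorm_eq_norm {m n : ℕ} (A : Matrix (Fin m) (Fin n) ℝ) :
    frobNorm A = ‖WithLp.toLp 2 (fun p : Fin m × Fin n => A p.1 p.2)‖ := by
  rw [EuclideanSpace.norm_eq, frobNorm, Fintype.sum_prod_type]
  simp

lemma frobNorm_add_le {m n : ℕ} (A B : Matrix (Fin m) (Fin n) ℝ) :
    frobNorm (A + B) ≤ frobNorm A + frobNorm B := by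
  simp only [frobNorm_eq_norm]
  exact norm_add_le (WithLp.toLp 2 (fun p : Fin m × Fin n => A p.1 p.2))
    (WithLp.toLp 2 (fun p : Fin m × Fin n => B p.1 p.2))

lemma frobNorm_one_sq (n : ℕ) : frobNorm (1 : Matrix (Fin n) (Fin n) ℝ) ^ 2 = n := by
  rw [frobNorm_sq]
  simp [Matrix.one_apply]

end FrobeniusNorm

section BatchNorm

variable {d n : ℕ}

/-- The average of the orthogonal projections onto the lines of the rows. -/
noncomputable def avgLineProj (y : Fin d → Fin n → ℝ) : Matrix (Fin n) (Fin n) ℝ :=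
  Matrix.of fun j k => 1 / (d : ℝ) * ∑ i, lineProj (y i) j k

lemma batchNorm_apply (M : Matrix (Fin d) (Fin n) ℝ) (i : Fin d) (j : Fin n) :
    batchNorm M i j = (Real.sqrt (∑ k, M i k ^ 2))⁻¹ * M i j := by
  rw [batchNorm, Matrix.diagonal_mul]
  simp only [Matrix.mul_apply, Matrix.transpose_apply, sq]

lemma batchNorm_mul_batchNorm (M : Matrix (Fin d) (Fin n) ℝ) (i : Fin d) (j k : Fin n) :
    batchNorm M i j * batchNorm M i k = lineProj (M i) j k := by
  rw [batchNorm_apply, batchNorm_apply, lineProj, div_eq_mul_inv]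
  have h : (Real.sqrt (∑ k, M i k ^ 2))⁻¹ * (Real.sqrt (∑ k, M i k ^ 2))⁻¹
      = (∑ k, M i k ^ 2)⁻¹ := by
    rw [← mul_inv, Real.mul_self_sqrt (Finset.sum_nonneg fun _ _ => sq_nonneg _)]
  rw [← h]
  ring

lemma transpose_mul_self_smul_batchNorm (M : Matrix (Fin d) (Fin n) ℝ) :
    ((1 / Real.sqrt d) • batchNorm M).transpose * ((1 / Real.sqrt d) • batchNorm M)
      = avgLineProj M := by
  ext j k
  rw [Matrix.transpose_smul, Matrix.smul_mul, Matrix.mul_smul, smul_smul, Matrix.smul_apply,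
    Matrix.mul_apply, smul_eq_mul]
  change _ = 1 / (d : ℝ) * ∑ i, lineProj (M i) j k
  congr 1
  · rw [div_mul_div_comm, Real.mul_self_sqrt (Nat.cast_nonneg d), one_mul]
  · exact Finset.sum_congr rfl fun i _ => batchNorm_mul_batchNorm M i j k

/-- The quotients x/x are kept because a zero row contributes 0: the norm is at most 1 always, and
equals 1 when no row vanishes. -/
lemma frobNorm_sq_smul_batchNorm (M : Matrix (Fin d) (Fin n) ℝ) :
    frobNorm ((1 / Real.sqrt d) • batchNorm M) ^ 2
      = 1 / d * ∑ i, (∑ j, M i j ^ 2) / ∑ j, M i j ^ 2 := by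
  rw [frobNorm_sq, Finset.mul_sum]
  refine Finset.sum_congr rfl fun i _ => ?_
  rw [Finset.sum_div, Finset.mul_sum]
  refine Finset.sum_congr rfl fun j _ => ?_
  rw [Matrix.smul_apply, smul_eq_mul, mul_pow, div_pow, Real.sq_sqrt (Nat.cast_nonneg d), one_pow,
    sq (batchNorm M i j), batchNorm_mul_batchNorm, lineProj, sq (M i j)]

lemma frobNorm_sq_smul_batchNorm_le_one (M : Matrix (Fin d) (Fin n) ℝ) :
    frobNorm ((1 / Real.sqrt d) • batchNorm M) ^ 2 ≤ 1 := by
  rw [frobNorm_sq_smul_batchNorm]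
  have h : ∑ i, (∑ j, M i j ^ 2) / ∑ j, M i j ^ 2 ≤ ∑ _i : Fin d, (1 : ℝ) :=
    Finset.sum_le_sum fun i _ => div_self_le_one _
  rw [Finset.sum_const, Finset.card_univ, Fintype.card_fin, nsmul_eq_mul, mul_one] at h
  calc _ ≤ 1 / (d : ℝ) * d := by gcongr
    _ ≤ 1 := by rw [one_div_mul_eq_div]; exact div_self_le_one _

lemma frobNorm_sq_smul_batchNorm_eq_one (hd : 0 < d) {M : Matrix (Fin d) (Fin n) ℝ}
    (hM : ∀ i, 0 < ∑ j, M i j ^ 2) :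
    frobNorm ((1 / Real.sqrt d) • batchNorm M) ^ 2 = 1 := by
  have hd' : (d : ℝ) ≠ 0 := by exact_mod_cast hd.ne'
  rw [frobNorm_sq_smul_batchNorm, Finset.sum_congr rfl fun i _ => div_self (hM i).ne']
  simp [hd']

lemma orthogonalityGap_smul_batchNorm (hd : 0 < d) {M : Matrix (Fin d) (Fin n) ℝ}
    (hM : ∀ i, 0 < ∑ j, M i j ^ 2) :
    orthogonalityGap ((1 / Real.sqrt d) • batchNorm M)
      = frobNorm (avgLineProj M - (1 / (n : ℝ)) • 1) := by
  rw [orthogonalityGap, frobNorm_sq_smul_batchNorm_eq_one hd hM, frobNorm_one_sq,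
    transpose_mul_self_smul_batchNorm]
  simp

end BatchNorm

/-! ### Concentration of the average projection -/

lemma sq_integral_le_integral_sq {Ω : Type*} [MeasurableSpace Ω] {P : Measure Ω}
    [IsProbabilityMeasure P] {Z : Ω → ℝ} (hZ : MemLp Z 2 P) :
    (∫ ω, Z ω ∂P) ^ 2 ≤ ∫ ω, Z ω ^ 2 ∂P := by
  have h1 := variance_eq_sub hZ
  have h2 := variance_nonneg Z P
  simp only [Pi.pow_apply] at h1
  linarith

section Concentration

variable {Ω : Type*} [MeasurableSpace Ω] {P : Measure Ω} [IsProbabilityMeasure P] {d n : ℕ}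
  {X : Fin d → Ω → Fin n → ℝ} {μ : Measure (Fin n → ℝ)}

lemma memLp_lineProj_comp (hX : ∀ i, HasLaw (X i) μ P) (i : Fin d) (j k : Fin n) :
    MemLp (fun ω => lineProj (X i ω) j k) 2 P :=
  MemLp.of_bound ((measurable_lineProj j k).comp_aemeasurable
    (hX i).aemeasurable).aestronglyMeasurable 1
    (Filter.Eventually.of_forall fun _ => abs_lineProj_le _ j k)

lemma memLp_avgLineProj (hX : ∀ i, HasLaw (X i) μ P) (j k : Fin n) :
    MemLp (fun ω => avgLineProj (fun i => X i ω) j k) 2 P := by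
  simp only [avgLineProj, Matrix.of_apply]
  exact (memLp_finsetSum _ fun i _ => memLp_lineProj_comp hX i j k).const_mul _

lemma integral_avgLineProj (hd : 0 < d) (hX : ∀ i, HasLaw (X i) μ P) (j k : Fin n) :
    ∫ ω, avgLineProj (fun i => X i ω) j k ∂P = ∫ y, lineProj y j k ∂μ := by
  have hd' : (d : ℝ) ≠ 0 := by exact_mod_cast hd.ne'
  simp only [avgLineProj, Matrix.of_apply]
  rw [integral_const_mul, integral_finsetSum _ fun i _ =>
    (memLp_lineProj_comp hX i j k).integrable one_le_two]
  have : ∀ i, ∫ ω, lineProj (X i ω) j k ∂P = ∫ y, lineProj y j k ∂μ := fun i =>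
    (hX i).integral_comp (measurable_lineProj j k).aestronglyMeasurable
  simp [this, hd']

lemma variance_avgLineProj_le (hd : 0 < d) (hX : ∀ i, HasLaw (X i) μ P) (hind : iIndepFun X P)
    (j k : Fin n) :
    Var[fun ω => avgLineProj (fun i => X i ω) j k; P] ≤ 1 / d * ∫ y, lineProj y j k ^ 2 ∂μ := by
  have hd' : (d : ℝ) ≠ 0 := by exact_mod_cast hd.ne'
  simp only [avgLineProj, Matrix.of_apply]
  rw [variance_const_mul]
  have h1 : Var[fun ω => ∑ i, lineProj (X i ω) j k; P]
      = ∑ i, Var[fun ω => lineProj (X i ω) j k; P] := by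
    have := IndepFun.variance_sum (μ := P) (s := Finset.univ)
      (X := fun i ω => lineProj (X i ω) j k) (fun i _ => memLp_lineProj_comp hX i j k)
      (fun i _ i' _ h => (hind.indepFun h).comp (measurable_lineProj j k) (measurable_lineProj j k))
    rw [← this]
    congr 1
    ext ω
    simp
  have h2 : ∀ i, Var[fun ω => lineProj (X i ω) j k; P] ≤ ∫ y, lineProj y j k ^ 2 ∂μ := by
    intro i
    refine (variance_le_expectation_sq (memLp_lineProj_comp hX i j k).aestronglyMeasurable).trans ?_
    exact ((hX i).integral_comp (f := fun y => lineProj y j k ^ 2)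
      ((measurable_lineProj j k).pow_const 2).aestronglyMeasurable).le
  rw [h1]
  calc _ ≤ (1 / (d : ℝ)) ^ 2 * ∑ _i : Fin d, ∫ y, lineProj y j k ^ 2 ∂μ := by
        gcongr with i
        exact h2 i
    _ = _ := by
        simp
        field_simp

/-- The average of `d` independent copies of a line projection is within `1/√d` of its mean. -/
lemma integral_frobNorm_avgLineProj_sub_mean_le [IsProbabilityMeasure μ] (hd : 0 < d)
    (hX : ∀ i, HasLaw (X i) μ P)
    (hind : iIndepFun X P) :
    Integrable (fun ω => frobNorm (avgLineProj (fun i => X i ω)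
      - Matrix.of fun j k => ∫ y, lineProj y j k ∂μ)) P ∧
    ∫ ω, frobNorm (avgLineProj (fun i => X i ω) - Matrix.of fun j k => ∫ y, lineProj y j k ∂μ) ∂P
      ≤ 1 / Real.sqrt d := by
  set Z : Ω → ℝ := fun ω => frobNorm (avgLineProj (fun i => X i ω)
      - Matrix.of fun j k => ∫ y, lineProj y j k ∂μ) with hZ
  have hm : ∀ j k, MemLp (fun ω => avgLineProj (fun i => X i ω) j k - ∫ y, lineProj y j k ∂μ) 2 P :=
    fun j k => (memLp_avgLineProj hX j k).sub (memLp_const _)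
  have hZsq : ∀ ω, Z ω ^ 2
      = ∑ j, ∑ k, (avgLineProj (fun i => X i ω) j k - ∫ y, lineProj y j k ∂μ) ^ 2 := fun ω => by
    rw [hZ, frobNorm_sq]
    simp
  have hint : Integrable (fun ω => Z ω ^ 2) P := by
    simp only [hZsq]
    exact integrable_finsetSum _ fun j _ => integrable_finsetSum _ fun k _ => (hm j k).integrable_sq
  have hZm : AEStronglyMeasurable Z P := by
    have h2 : Z = fun ω => Real.sqrt (Z ω ^ 2) := by
      funext ω
      rw [Real.sqrt_sq (frobNorm_nonneg _)]
    rw [h2]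
    exact (Real.continuous_sqrt.comp_aestronglyMeasurable hint.aestronglyMeasurable)
  have hZ2 : MemLp Z 2 P := (memLp_two_iff_integrable_sq hZm).2 hint
  refine ⟨hZ2.integrable one_le_two, ?_⟩
  -- The expected squared distance is the sum of the entrywise variances. Each is at most 1/d times
  -- a second moment, and a line projection has squared Frobenius norm at most 1, so no factor of n
  -- appears.
  have hvar : ∫ ω, Z ω ^ 2 ∂P ≤ 1 / d := by
    simp only [hZsq]
    rw [integral_finsetSum _ fun j _ => integrable_finsetSum _ fun k _ => (hm j k).integrable_sq]
    have h1 : ∀ j, ∫ ω, ∑ k, (avgLineProj (fun i => X i ω) j k - ∫ y, lineProj y j k ∂μ) ^ 2 ∂P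
        = ∑ k, Var[fun ω => avgLineProj (fun i => X i ω) j k; P] := by
      intro j
      rw [integral_finsetSum _ fun k _ => (hm j k).integrable_sq]
      refine Finset.sum_congr rfl fun k _ => ?_
      rw [variance_eq_integral (memLp_avgLineProj hX j k).aemeasurable,
        integral_avgLineProj hd hX]
    simp only [h1]
    have hb : ∀ j k, Integrable (fun y => lineProj y j k ^ 2) μ := fun j k =>
      Integrable.of_bound ((measurable_lineProj j k).pow_const 2).aestronglyMeasurable 1
        (Filter.Eventually.of_forall fun y => by
          rw [Real.norm_of_nonneg (sq_nonneg _), sq_le_one_iff_abs_le_one]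
          exact abs_lineProj_le y j k)
    calc _ ≤ ∑ j, ∑ k, 1 / (d : ℝ) * ∫ y, lineProj y j k ^ 2 ∂μ :=
          Finset.sum_le_sum fun j _ => Finset.sum_le_sum fun k _ =>
            variance_avgLineProj_le hd hX hind j k
      _ = 1 / d * ∫ y, ∑ j, ∑ k, lineProj y j k ^ 2 ∂μ := by
          rw [integral_finsetSum _ fun j _ => integrable_finsetSum _ fun k _ => hb j k]
          simp only [integral_finsetSum _ fun k _ => hb _ k, Finset.mul_sum]
      _ ≤ 1 / d * ∫ _, 1 ∂μ := by
          gcongr ?_ * ?_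
          refine integral_mono ?_ (integrable_const _) fun y => sum_sq_lineProj_le y
          exact integrable_finsetSum _ fun j _ => integrable_finsetSum _ fun k _ => hb j k
      _ = _ := by simp
  have h0 : 0 ≤ ∫ ω, Z ω ∂P := integral_nonneg fun ω => frobNorm_nonneg _
  rw [← Real.sqrt_one, ← Real.sqrt_div zero_le_one]
  exact Real.le_sqrt_of_sq_le ((sq_integral_le_integral_sq hZ2).trans hvar)

end Concentration

/-! ### One layer in a diagonalizing frame, and the law of its Gaussian rows -/

section DiagonalStep

variable {Ω : Type*} [MeasurableSpace Ω] {P : Measure Ω} [IsProbabilityMeasure P] {d n : ℕ}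

/-- One layer of batch normalization contracts the orthogonality gap in expectation, in an
orthogonal frame for the incoming representation. -/
lemma integral_orthogonalityGap_le_of_indep_rows (hn : 0 < n) (hd : 0 < d) {q : Fin n → ℝ}
    {a : ℝ} (ha : 0 < a) (hq : ∀ j, a ≤ q j) (hsum : ∑ j, q j = 1)
    {X : Ω → Matrix (Fin d) (Fin n) ℝ} (hX : ∀ i, HasLaw (fun ω => X ω i) (gaussianPi q) P)
    (hind : iIndepFun (fun i ω => X ω i) P) :
    ∫ ω, orthogonalityGap ((1 / Real.sqrt d) • batchNorm (X ω)) ∂P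
      ≤ (1 - 2 / 3 * a) * Real.sqrt (∑ j, (q j - 1 / n) ^ 2) + 1 / Real.sqrt d := by
  set M : Matrix (Fin n) (Fin n) ℝ := Matrix.of fun j k => ∫ y, lineProj y j k ∂gaussianPi q
    with hM
  obtain ⟨h1, h2⟩ := integral_frobNorm_avgLineProj_sub_mean_le hd hX hind
  have h3 : frobNorm (M - (1 / (n : ℝ)) • 1)
      = Real.sqrt (∑ j, (∫ y, lineProj y j j ∂gaussianPi q - 1 / n) ^ 2) := by
    rw [frobNorm]
    congr 1
    refine Finset.sum_congr rfl fun j _ => ?_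
    rw [Finset.sum_eq_single j]
    · simp [hM]
    · intro k _ hk
      simp [hM, integral_lineProj_of_ne q hk.symm, Matrix.one_apply_ne hk.symm]
    · simp
  have hpos : ∀ᵐ ω ∂P, ∀ i, 0 < ∑ j, X ω i j ^ 2 := by
    rw [ae_all_iff]
    intro i
    have h := ae_gaussianPi_sum_sq_pos hn fun j => ha.trans_le (hq j)
    rw [← (hX i).map_eq] at h
    exact ae_of_ae_map (hX i).aemeasurable h
  have h4 : ∫ ω, orthogonalityGap ((1 / Real.sqrt d) • batchNorm (X ω)) ∂P
      ≤ ∫ ω, (frobNorm (avgLineProj (X ω) - M) + frobNorm (M - (1 / (n : ℝ)) • 1)) ∂P := by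
    refine integral_mono_of_nonneg (Filter.Eventually.of_forall fun ω => frobNorm_nonneg _)
      (h1.add (integrable_const _)) ?_
    filter_upwards [hpos] with ω hω
    rw [orthogonalityGap_smul_batchNorm hd hω]
    have := frobNorm_add_le (avgLineProj (X ω) - M) (M - (1 / (n : ℝ)) • 1)
    rwa [sub_add_sub_cancel] at this
  have h5 := sum_sq_integral_lineProj_sub_le hn ha hq hsum
  rw [integral_add h1 (integrable_const _)] at h4
  simp only [integral_const, probReal_univ, one_smul, h3] at h4
  linarith

end DiagonalStep

section GaussianRows

variable {Ω : Type*} [MeasurableSpace Ω] {P : Measure Ω} {d n : ℕ}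
  {A : Ω → Matrix (Fin d) (Fin d) ℝ}

lemma covariance_gaussian_mul_apply [IsProbabilityMeasure P]
    (hA : ∀ i j, HasLaw (fun ω => A ω i j) (gaussianReal 0 ((d : ℝ≥0)⁻¹)) P)
    (hind : iIndepFun (fun (p : Fin d × Fin d) ω => A ω p.1 p.2) P)
    (H : Matrix (Fin d) (Fin n) ℝ) (i i' : Fin d) (j j' : Fin n) :
    cov[fun ω => (A ω * H) i j, fun ω => (A ω * H) i' j'; P]
      = if i = i' then (d : ℝ)⁻¹ * (H.transpose * H) j j' else 0 := by
  have hmem : ∀ i k, MemLp (fun ω => A ω i k) 2 P := fun i k => (hA i k).hasGaussianLaw.memLp_two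
  have hcov : ∀ i k i' k', cov[fun ω => A ω i k, fun ω => A ω i' k'; P]
      = if (i, k) = (i', k') then (d : ℝ)⁻¹ else 0 := by
    intro i k i' k'
    split_ifs with h
    · obtain ⟨rfl, rfl⟩ := Prod.mk.inj h
      rw [covariance_self (hA i k).aemeasurable, (hA i k).variance_eq, variance_id_gaussianReal]
      simp
    · exact (hind.indepFun h).covariance_eq_zero (hmem i k) (hmem i' k')
  simp only [Matrix.mul_apply, Matrix.transpose_apply]
  rw [covariance_fun_sum_fun_sum (fun k => (hmem i k).mul_const _)
    (fun k => (hmem i' k).mul_const _)]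
  simp only [covariance_mul_const_left, covariance_mul_const_right, hcov, Prod.mk.injEq]
  split_ifs with h
  · rw [Finset.mul_sum]
    refine Finset.sum_congr rfl fun k _ => ?_
    simp [h]
    ring
  · simp [h]

lemma hasGaussianLaw_gaussian_mul
    (hA : ∀ i j, HasLaw (fun ω => A ω i j) (gaussianReal 0 ((d : ℝ≥0)⁻¹)) P)
    (hind : iIndepFun (fun (p : Fin d × Fin d) ω => A ω p.1 p.2) P)
    (H : Matrix (Fin d) (Fin n) ℝ) :
    HasGaussianLaw (fun ω (i : Fin d) (j : Fin n) => (A ω * H) i j) P := by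
  have h1 : HasGaussianLaw (fun ω (p : Fin d × Fin d) => A ω p.1 p.2) P :=
    hind.hasGaussianLaw fun p => (hA p.1 p.2).hasGaussianLaw
  let L : (Fin d × Fin d → ℝ) →L[ℝ] (Fin d → Fin n → ℝ) :=
    ContinuousLinearMap.pi fun i => ContinuousLinearMap.pi fun j =>
      ∑ k, H k j • ContinuousLinearMap.proj (R := ℝ) (φ := fun _ : Fin d × Fin d => ℝ) (i, k)
  have h2 := h1.map_fun L
  refine h2.congr (Filter.Eventually.of_forall fun ω => ?_)
  ext i j
  simp [L, Matrix.mul_apply, mul_comm]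

lemma integral_gaussian_mul_apply
    (hA : ∀ i j, HasLaw (fun ω => A ω i j) (gaussianReal 0 ((d : ℝ≥0)⁻¹)) P)
    (H : Matrix (Fin d) (Fin n) ℝ) (i : Fin d) (j : Fin n) :
    ∫ ω, (A ω * H) i j ∂P = 0 := by
  simp only [Matrix.mul_apply]
  rw [integral_finsetSum _ fun k _ => ((hA i k).hasGaussianLaw.integrable).mul_const _]
  refine Finset.sum_eq_zero fun k _ => ?_
  rw [integral_mul_const, (hA i k).integral_eq]
  simp

/-- A row of A·H is jointly Gaussian with covariance HᵀH/d; orthogonal columns make its coordinates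
uncorrelated, hence independent. -/
lemma hasLaw_gaussian_mul_row [IsProbabilityMeasure P]
    (hA : ∀ i j, HasLaw (fun ω => A ω i j) (gaussianReal 0 ((d : ℝ≥0)⁻¹)) P)
    (hind : iIndepFun (fun (p : Fin d × Fin d) ω => A ω p.1 p.2) P) (hd : 0 < d)
    {H : Matrix (Fin d) (Fin n) ℝ} {q : Fin n → ℝ}
    (hH : H.transpose * H = (d : ℝ) • Matrix.diagonal q) (i : Fin d) :
    HasLaw (fun ω => (A ω * H) i) (gaussianPi q) P := by
  have hd' : (d : ℝ) ≠ 0 := by exact_mod_cast hd.ne'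
  have hG := (hasGaussianLaw_gaussian_mul hA hind H).eval i
  have hcov := fun j j' => covariance_gaussian_mul_apply hA hind H i i j j'
  refine iIndepFun.hasLaw_pi (X := fun j ω => (A ω * H) i j) (fun j => ?_) ?_
  · refine ⟨(hG.eval j).aemeasurable, ?_⟩
    rw [(hG.eval j).map_eq_gaussianReal, integral_gaussian_mul_apply hA,
      ← covariance_self (hG.eval j).aemeasurable, hcov, hH]
    simp [hd']
  · refine HasGaussianLaw.iIndepFun_of_covariance_eq_zero hG fun j j' hj => ?_
    rw [hcov, hH]
    simp [hj]

lemma iIndepFun_gaussian_mul_row [IsProbabilityMeasure P]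
    (hA : ∀ i j, HasLaw (fun ω => A ω i j) (gaussianReal 0 ((d : ℝ≥0)⁻¹)) P)
    (hind : iIndepFun (fun (p : Fin d × Fin d) ω => A ω p.1 p.2) P)
    (H : Matrix (Fin d) (Fin n) ℝ) :
    iIndepFun (fun i ω => (A ω * H) i) P :=
  HasGaussianLaw.iIndepFun_of_covariance_eval (X := fun i j ω => (A ω * H) i j)
    (hasGaussianLaw_gaussian_mul hA hind H) fun i i' h j j' => by
      rw [covariance_gaussian_mul_apply hA hind, if_neg h]

end GaussianRows

/-! ### Orthogonal and scale invariance, and the bound V ≤ 1 -/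

section Invariance

variable {d m n : ℕ}

lemma frobNorm_sq_eq_trace (A : Matrix (Fin m) (Fin n) ℝ) :
    frobNorm A ^ 2 = (A * A.transpose).trace := by
  rw [frobNorm_sq]
  simp [Matrix.trace, Matrix.mul_apply, sq]

lemma frobNorm_sq_eq_trace_transpose (A : Matrix (Fin m) (Fin n) ℝ) :
    frobNorm A ^ 2 = (A.transpose * A).trace := by
  rw [frobNorm_sq_eq_trace, Matrix.trace_mul_comm]

lemma frobNorm_mul_orthogonal (A : Matrix (Fin m) (Fin n) ℝ) {U : Matrix (Fin n) (Fin n) ℝ}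
    (hU : U * U.transpose = 1) : frobNorm (A * U) = frobNorm A := by
  rw [← sq_eq_sq₀ (frobNorm_nonneg _) (frobNorm_nonneg _), frobNorm_sq_eq_trace,
    frobNorm_sq_eq_trace, Matrix.transpose_mul, Matrix.mul_assoc, ← Matrix.mul_assoc U, hU,
    Matrix.one_mul]

lemma frobNorm_orthogonal_mul (A : Matrix (Fin m) (Fin n) ℝ) {U : Matrix (Fin m) (Fin m) ℝ}
    (hU : U * U.transpose = 1) : frobNorm (U.transpose * A) = frobNorm A := by
  rw [← sq_eq_sq₀ (frobNorm_nonneg _) (frobNorm_nonneg _), frobNorm_sq_eq_trace_transpose,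
    frobNorm_sq_eq_trace_transpose, Matrix.transpose_mul, Matrix.transpose_transpose,
    Matrix.mul_assoc, ← Matrix.mul_assoc U, hU, Matrix.one_mul]

lemma orthogonalityGap_mul_orthogonal (H : Matrix (Fin d) (Fin n) ℝ)
    {U : Matrix (Fin n) (Fin n) ℝ} (hU : U * U.transpose = 1) :
    orthogonalityGap (H * U) = orthogonalityGap H := by
  have hU' : U.transpose * U = 1 := mul_eq_one_comm.1 hU
  rw [orthogonalityGap, orthogonalityGap, frobNorm_mul_orthogonal H hU]
  set c := 1 / frobNorm H ^ 2
  set e := 1 / frobNorm (1 : Matrix (Fin n) (Fin n) ℝ) ^ 2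
  have h : c • ((H * U).transpose * (H * U)) - e • (1 : Matrix (Fin n) (Fin n) ℝ)
      = U.transpose * ((c • (H.transpose * H) - e • 1) * U) := by
    rw [Matrix.transpose_mul, Matrix.sub_mul, Matrix.mul_sub]
    simp only [Matrix.smul_mul, Matrix.mul_smul, Matrix.one_mul, hU', Matrix.mul_assoc]
  rw [h, frobNorm_orthogonal_mul _ hU, frobNorm_mul_orthogonal _ hU]

lemma batchNorm_mul_orthogonal (M : Matrix (Fin d) (Fin n) ℝ)
    {U : Matrix (Fin n) (Fin n) ℝ} (hU : U * U.transpose = 1) :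
    batchNorm (M * U) = batchNorm M * U := by
  have h : M * U * (M * U).transpose = M * M.transpose := by
    rw [Matrix.transpose_mul, Matrix.mul_assoc, ← Matrix.mul_assoc U, hU, Matrix.one_mul]
  rw [batchNorm, batchNorm, h, Matrix.mul_assoc]

lemma batchNorm_smul {c : ℝ} (hc : 0 < c) (M : Matrix (Fin d) (Fin n) ℝ) :
    batchNorm (c • M) = batchNorm M := by
  ext i j
  simp only [batchNorm_apply, Matrix.smul_apply, smul_eq_mul, mul_pow, ← Finset.mul_sum]
  rw [Real.sqrt_mul (sq_nonneg c), Real.sqrt_sq hc.le]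
  field_simp

/-- For H ≠ 0 the normalized Gram matrix G has trace 1 and Frobenius norm at most 1, so ‖G - I/n‖² =
‖G‖² - 1/n. For H = 0 the gap is ‖I/n‖_F = 1/√n when n > 0. -/
lemma orthogonalityGap_le_one (H : Matrix (Fin d) (Fin n) ℝ) : orthogonalityGap H ≤ 1 := by
  rw [orthogonalityGap, frobNorm_one_sq]
  apply Real.sqrt_le_one.2
  set c := frobNorm H ^ 2 with hc
  set G : Matrix (Fin n) (Fin n) ℝ := (1 / c) • (H.transpose * H) with hG
  have hGG : ∑ j, ∑ k, G j k ^ 2 ≤ 1 := by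
    have h1 : ∀ j k, (H.transpose * H) j k ^ 2 ≤ (∑ i, H i j ^ 2) * ∑ i, H i k ^ 2 := by
      intro j k
      rw [Matrix.mul_apply]
      exact Finset.sum_mul_sq_le_sq_mul_sq _ _ _
    have h2 : ∑ j, ∑ k, (H.transpose * H) j k ^ 2 ≤ c ^ 2 := by
      calc _ ≤ ∑ j, ∑ k, (∑ i, H i j ^ 2) * ∑ i, H i k ^ 2 :=
            Finset.sum_le_sum fun j _ => Finset.sum_le_sum fun k _ => h1 j k
        _ = c ^ 2 := by
            simp only [← Finset.mul_sum, ← Finset.sum_mul]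
            rw [hc, frobNorm_sq, Finset.sum_comm, ← sq]
    calc ∑ j, ∑ k, G j k ^ 2 = (∑ j, ∑ k, (H.transpose * H) j k ^ 2) / c ^ 2 := by
          simp only [hG, Matrix.smul_apply, smul_eq_mul, mul_pow, ← Finset.mul_sum, div_pow,
            one_pow]
          ring
      _ ≤ c ^ 2 / c ^ 2 := by gcongr
      _ ≤ 1 := div_self_le_one _
  have htr : ∑ j, G j j = c / c := by
    rw [hc, frobNorm_sq_eq_trace_transpose, hG]
    simp only [Matrix.smul_apply, smul_eq_mul, ← Finset.mul_sum]
    rw [← frobNorm_sq_eq_trace_transpose, ← hc, one_div, inv_mul_eq_div]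
    congr 1
    rw [hc, frobNorm_sq_eq_trace_transpose, Matrix.trace]
    rfl
  have hexp : ∑ j, ∑ k, (G - (1 / (n : ℝ)) • 1) j k ^ 2
      = ∑ j, ∑ k, G j k ^ 2 - 2 / n * ∑ j, G j j + n * (1 / n) ^ 2 := by
    have h1 : ∀ j k, (G - (1 / (n : ℝ)) • (1 : Matrix (Fin n) (Fin n) ℝ)) j k ^ 2
        = G j k ^ 2 - (if j = k then 2 / n * G j k - (1 / n) ^ 2 else 0) := by
      intro j k
      rw [Matrix.sub_apply, Matrix.smul_apply, Matrix.one_apply]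
      split_ifs
      · simp; ring
      · simp
    simp only [h1, Finset.sum_sub_distrib, Finset.sum_ite_eq, Finset.mem_univ, if_true,
      ← Finset.mul_sum]
    simp
    ring
  rw [hexp, htr]
  rcases Nat.eq_zero_or_pos n with rfl | hn
  · simp
  have hn1 : (1 : ℝ) ≤ n := by exact_mod_cast hn
  have hn2 : (n : ℝ) * (1 / n) ^ 2 = 1 / n := by field_simp
  have hinv : 1 / (n : ℝ) ≤ 1 := by rw [div_le_one (by positivity)]; exact hn1
  rw [hn2]
  by_cases h0 : c = 0
  · have : ∑ j, ∑ k, G j k ^ 2 = 0 := by simp [hG, h0]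
    rw [this, h0]
    simpa using hinv
  · rw [div_self h0]
    have : (2 : ℝ) / n * 1 = 2 * (1 / n) := by ring
    have : 0 ≤ 1 / (n : ℝ) := by positivity
    linarith

end Invariance

/-! ### Smallest singular value and diagonalization -/

section MinSingularValue

variable {d n : ℕ}

/-- Rayleigh quotient: expand in an eigenbasis of HᵀH, and test on the last eigenvector for the
converse. This form bounds the diagonal Gram entries in any frame and exhibits the conditioning
event as a closed condition. -/
lemma le_sq_minSingularValue_iff (hn : 0 < n) (H : Matrix (Fin d) (Fin n) ℝ) (a : ℝ) :
    a ≤ minSingularValue H ^ 2 ↔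
      ∀ v : Fin n → ℝ, a * ∑ j, v j ^ 2 ≤ ∑ i, (H.mulVec v) i ^ 2 := by
  set T := Matrix.toEuclideanLin H with hT
  have hfin : Module.finrank ℝ (EuclideanSpace ℝ (Fin n)) = n := by simp
  have hS := T.isSymmetric_adjoint_comp_self
  have hσ : minSingularValue H ^ 2 = hS.eigenvalues hfin ⟨n - 1, by omega⟩ := by
    rw [minSingularValue, ← hT, T.sq_singularValues_of_lt hfin (by omega : n - 1 < n)]
  have hnorm : ∀ v : EuclideanSpace ℝ (Fin n), ‖T v‖ ^ 2 = ∑ i, (H.mulVec v.ofLp) i ^ 2 := by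
    intro v
    rw [EuclideanSpace.norm_sq_eq]
    simp [hT, Matrix.toLpLin_apply]
  have hinner : ∀ v : EuclideanSpace ℝ (Fin n),
      ‖T v‖ ^ 2 = inner ℝ v ((LinearMap.adjoint T ∘ₗ T) v) := by
    intro v
    rw [LinearMap.comp_apply, LinearMap.adjoint_inner_right, real_inner_self_eq_norm_sq]
  set b := hS.eigenvectorBasis hfin
  rw [hσ]
  constructor
  · intro h v
    set x : EuclideanSpace ℝ (Fin n) := WithLp.toLp 2 v
    have h1 : ‖T x‖ ^ 2 = ∑ i, hS.eigenvalues hfin i * b.repr x i ^ 2 := by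
      rw [hinner, ← b.repr.inner_map_map, PiLp.inner_apply]
      refine Finset.sum_congr rfl fun i _ => ?_
      rw [hS.eigenvectorBasis_apply_self_apply hfin x i]
      simp [b]
      ring
    have h2 : ∑ j, v j ^ 2 = ∑ i, b.repr x i ^ 2 := by
      have := b.repr.norm_map x
      have h3 : ‖b.repr x‖ ^ 2 = ‖x‖ ^ 2 := by rw [this]
      rw [EuclideanSpace.norm_sq_eq, EuclideanSpace.norm_sq_eq] at h3
      simpa [x] using h3.symm
    have h4 := hnorm x
    rw [h1] at h4
    rw [← h4, h2, Finset.mul_sum]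
    refine Finset.sum_le_sum fun i _ => mul_le_mul_of_nonneg_right (h.trans ?_) (sq_nonneg _)
    exact hS.eigenvalues_antitone hfin (Fin.mk_le_mk.2 (by omega))
  · intro h
    set e := b ⟨n - 1, by omega⟩ with he
    have he1 : ‖e‖ ^ 2 = 1 := by rw [b.orthonormal.1]; norm_num
    have h1 := h e.ofLp
    rw [← hnorm, hinner, hS.apply_eigenvectorBasis hfin, inner_smul_right,
      real_inner_self_eq_norm_sq] at h1
    have h2 : ∑ j, e.ofLp j ^ 2 = 1 := by
      rw [← he1, EuclideanSpace.norm_sq_eq]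
      simp
    rw [h2, he1] at h1
    simpa using h1

lemma exists_orthogonal_diagonalization (H : Matrix (Fin d) (Fin n) ℝ) :
    ∃ (U : Matrix (Fin n) (Fin n) ℝ) (q : Fin n → ℝ), U * U.transpose = 1 ∧
      (H * U).transpose * (H * U) = Matrix.diagonal q := by
  have hH : (H.transpose * H).IsHermitian := by
    have := Matrix.isHermitian_conjTranspose_mul_self H
    rwa [Matrix.conjTranspose_eq_transpose_of_trivial] at this
  set U : Matrix (Fin n) (Fin n) ℝ := (hH.eigenvectorUnitary : Matrix (Fin n) (Fin n) ℝ) with hUdef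
  have hstar : star U = U.transpose := by
    rw [Matrix.star_eq_conjTranspose, Matrix.conjTranspose_eq_transpose_of_trivial]
  have hU : U * U.transpose = 1 := by
    rw [← hstar]
    exact Unitary.coe_mul_star_self hH.eigenvectorUnitary
  have hU' : U.transpose * U = 1 := mul_eq_one_comm.1 hU
  have h := hH.spectral_theorem
  rw [Unitary.conjStarAlgAut_apply, ← Unitary.coe_star, Unitary.coe_star, ← hUdef, hstar] at h
  have h2 : (Matrix.diagonal (RCLike.ofReal ∘ hH.eigenvalues) : Matrix (Fin n) (Fin n) ℝ)
      = Matrix.diagonal hH.eigenvalues := by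
    congr 1
  rw [h2] at h
  obtain ⟨q, hq⟩ : ∃ q, q = hH.eigenvalues := ⟨_, rfl⟩
  rw [← hq] at h
  refine ⟨U, q, hU, ?_⟩
  rw [Matrix.transpose_mul, Matrix.mul_assoc, ← Matrix.mul_assoc H.transpose, h, Matrix.mul_assoc,
    Matrix.mul_assoc, hU', Matrix.mul_one, ← Matrix.mul_assoc, hU', Matrix.one_mul]

end MinSingularValue

/-! ### Contraction by one Gaussian layer -/

section OneStep

variable {Ω : Type*} [MeasurableSpace Ω] {P : Measure Ω} [IsProbabilityMeasure P] {d n : ℕ}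
  {A : Ω → Matrix (Fin d) (Fin d) ℝ}

lemma orthogonalityGap_of_transpose_mul_self_eq_diagonal {H : Matrix (Fin d) (Fin n) ℝ}
    {q : Fin n → ℝ} (h : H.transpose * H = Matrix.diagonal q) :
    orthogonalityGap H = Real.sqrt (∑ j, (q j / frobNorm H ^ 2 - 1 / n) ^ 2) := by
  rw [orthogonalityGap, frobNorm_one_sq, h, frobNorm]
  congr 1
  refine Finset.sum_congr rfl fun j _ => ?_
  rw [Finset.sum_eq_single j]
  · simp
    ring
  · intro k _ hk
    simp [Matrix.one_apply_ne hk.symm, Matrix.diagonal_apply_ne _ hk.symm]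
  · simp

/-- One layer with Gaussian weights contracts the orthogonality gap of a representation whose
squared singular values are at least `a`, up to an error `1/√d`. -/
lemma integral_orthogonalityGap_layer_le (hn : 0 < n) (hd : 0 < d)
    (hA : ∀ i j, HasLaw (fun ω => A ω i j) (gaussianReal 0 ((d : ℝ≥0)⁻¹)) P)
    (hind : iIndepFun (fun (p : Fin d × Fin d) ω => A ω p.1 p.2) P)
    {H : Matrix (Fin d) (Fin n) ℝ} {a : ℝ} (ha : 0 < a) (hHa : a ≤ minSingularValue H ^ 2)
    (hH1 : frobNorm H ^ 2 ≤ 1) :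
    ∫ ω, orthogonalityGap ((1 / Real.sqrt d) • batchNorm (A ω * H)) ∂P
      ≤ (1 - 2 / 3 * a) * orthogonalityGap H + 1 / Real.sqrt d := by
  have : NeZero n := ⟨hn.ne'⟩
  have hdR : (0 : ℝ) < d := by exact_mod_cast hd
  obtain ⟨U, q, hU, hdiag⟩ := exists_orthogonal_diagonalization H
  have hU' : U.transpose * U = 1 := mul_eq_one_comm.1 hU
  have hqa : ∀ j, a ≤ q j := by
    intro j
    have h := (le_sq_minSingularValue_iff hn H a).1 hHa (fun k => U k j)
    have h1 : ∑ k, U k j ^ 2 = 1 := by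
      have := congrFun (congrFun hU' j) j
      simpa [Matrix.mul_apply, sq] using this
    have h2 : ∑ i, (H.mulVec fun k => U k j) i ^ 2 = q j := by
      have := congrFun (congrFun hdiag j) j
      simpa [Matrix.mul_apply, sq, Matrix.mulVec, dotProduct, -Matrix.transpose_mul] using this
    rw [h1, h2] at h
    linarith
  set c := frobNorm H ^ 2 with hc
  have hqsum : ∑ j, q j = c := by
    rw [hc, ← frobNorm_mul_orthogonal H hU, frobNorm_sq_eq_trace_transpose, hdiag,
      Matrix.trace_diagonal]
  have hcpos : 0 < c := by
    rw [← hqsum]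
    exact Finset.sum_pos (fun j _ => ha.trans_le (hqa j)) Finset.univ_nonempty
  -- Rescaling cancels the variance 1/d of the weights and normalizes the row variances q_j/c to sum
  -- 1; batch normalization does not see it.
  set s := Real.sqrt (d / c) with hs
  have hspos : 0 < s := Real.sqrt_pos.2 (by positivity)
  have hK : (s • (H * U)).transpose * (s • (H * U)) = (d : ℝ) • Matrix.diagonal fun j => q j / c := by
    rw [Matrix.transpose_smul, Matrix.smul_mul, Matrix.mul_smul, smul_smul, hdiag, hs,
      Real.mul_self_sqrt (by positivity), ← Matrix.diagonal_smul, ← Matrix.diagonal_smul]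
    congr 1
    funext j
    simp
    ring
  have hstep := integral_orthogonalityGap_le_of_indep_rows hn hd ha (q := fun j => q j / c)
    -- Here ‖H‖_F ≤ 1 enters: dividing by c ≤ 1 keeps the variances above a.
    (fun j => (hqa j).trans (le_div_self (ha.le.trans (hqa j)) hcpos hH1))
    (by rw [← Finset.sum_div, hqsum, div_self hcpos.ne'])
    (fun i => hasLaw_gaussian_mul_row hA hind hd hK i)
    (iIndepFun_gaussian_mul_row hA hind (s • (H * U)))
  have hV : orthogonalityGap H = Real.sqrt (∑ j, (q j / c - 1 / n) ^ 2) := by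
    rw [← orthogonalityGap_mul_orthogonal H hU,
      orthogonalityGap_of_transpose_mul_self_eq_diagonal hdiag, frobNorm_mul_orthogonal H hU]
  have hB : ∀ ω, orthogonalityGap ((1 / Real.sqrt d) • batchNorm (A ω * (s • (H * U))))
      = orthogonalityGap ((1 / Real.sqrt d) • batchNorm (A ω * H)) := by
    intro ω
    rw [Matrix.mul_smul, batchNorm_smul hspos, ← Matrix.mul_assoc, batchNorm_mul_orthogonal _ hU,
      ← Matrix.smul_mul, orthogonalityGap_mul_orthogonal _ hU]
  simp only [hB] at hstep
  rwa [hV]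

/-- For a single sample the representation after a Gaussian layer has no orthogonality gap. -/
lemma ae_orthogonalityGap_layer_eq_zero (hd : 0 < d)
    (hA : ∀ i j, HasLaw (fun ω => A ω i j) (gaussianReal 0 ((d : ℝ≥0)⁻¹)) P)
    (hind : iIndepFun (fun (p : Fin d × Fin d) ω => A ω p.1 p.2) P)
    {H : Matrix (Fin d) (Fin 1) ℝ} (hH : 0 < frobNorm H ^ 2) :
    ∀ᵐ ω ∂P, orthogonalityGap ((1 / Real.sqrt d) • batchNorm (A ω * H)) = 0 := by
  have hdR : (0 : ℝ) < d := by exact_mod_cast hd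
  have hdiag : H.transpose * H = (d : ℝ) • Matrix.diagonal fun _ => frobNorm H ^ 2 / d := by
    ext i j
    obtain rfl := Subsingleton.elim i 0
    obtain rfl := Subsingleton.elim j 0
    rw [frobNorm_sq_eq_trace_transpose]
    simp [Matrix.trace]
    field_simp
  have hpos : ∀ᵐ ω ∂P, ∀ i, 0 < ∑ j, (A ω * H) i j ^ 2 := by
    rw [ae_all_iff]
    intro i
    have hlaw := hasLaw_gaussian_mul_row hA hind hd hdiag i
    have h := ae_gaussianPi_sum_sq_pos one_pos (q := fun _ : Fin 1 => frobNorm H ^ 2 / d)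
      fun _ => by positivity
    rw [← hlaw.map_eq] at h
    exact ae_of_ae_map hlaw.aemeasurable h
  filter_upwards [hpos] with ω hω
  rw [orthogonalityGap_smul_batchNorm hd hω, frobNorm]
  have h1 : ∀ i, lineProj ((A ω * H) i) 0 0 = 1 := by
    intro i
    have := hω i
    rw [lineProj]
    simp only [Fin.sum_univ_one] at this ⊢
    rw [← sq, div_self this.ne']
  have h2 : avgLineProj (A ω * H) 0 0 = 1 := by
    change 1 / (d : ℝ) * ∑ i, lineProj ((A ω * H) i) 0 0 = 1
    simp [h1, hdR.ne']
  simp [h2]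

end OneStep

/-! ### Measurability, dependence on the past, and conditioning -/

section Measurability

variable {S : Type*} [MeasurableSpace S] {d m n : ℕ}

lemma measurable_batchNorm_apply {M : S → Matrix (Fin d) (Fin n) ℝ}
    (hM : ∀ i j, Measurable fun s => M s i j) (i : Fin d) (j : Fin n) :
    Measurable fun s => ((1 / Real.sqrt d) • batchNorm (M s)) i j := by
  simp only [Matrix.smul_apply, batchNorm_apply, smul_eq_mul]
  fun_prop

lemma measurable_mul_apply {M : S → Matrix (Fin d) (Fin m) ℝ} {N : S → Matrix (Fin m) (Fin n) ℝ}
    (hM : ∀ i j, Measurable fun s => M s i j) (hN : ∀ i j, Measurable fun s => N s i j)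
    (i : Fin d) (j : Fin n) : Measurable fun s => (M s * N s) i j := by
  simp only [Matrix.mul_apply]
  fun_prop

lemma measurable_orthogonalityGap {M : S → Matrix (Fin d) (Fin n) ℝ}
    (hM : ∀ i j, Measurable fun s => M s i j) : Measurable fun s => orthogonalityGap (M s) := by
  simp only [orthogonalityGap, frobNorm, Matrix.sub_apply, Matrix.smul_apply, Matrix.mul_apply,
    Matrix.transpose_apply, smul_eq_mul]
  fun_prop

lemma measurable_hiddenRep_apply (H₀ : Matrix (Fin d) (Fin n) ℝ)
    {W : S → ℕ → Matrix (Fin d) (Fin d) ℝ} (hW : ∀ k i j, Measurable fun s => W s k i j)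
    (k : ℕ) : ∀ i j, Measurable fun s => hiddenRep H₀ (W s) k i j := by
  induction k with
  | zero => exact fun i j => measurable_const
  | succ k ih => exact measurable_batchNorm_apply (measurable_mul_apply (hW k) ih)

lemma measurableSet_le_sq_minSingularValue (hn : 0 < n) {M : S → Matrix (Fin d) (Fin n) ℝ}
    (hM : ∀ i j, Measurable fun s => M s i j) (a : ℝ) :
    MeasurableSet {s | a ≤ minSingularValue (M s) ^ 2} := by
  -- An intersection over all test vectors v, uncountable but closed, hence still measurable.
  have hclosed : IsClosed {y : Fin d → Fin n → ℝ |
      ∀ v : Fin n → ℝ, a * ∑ j, v j ^ 2 ≤ ∑ i, (∑ j, y i j * v j) ^ 2} := by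
    simp only [Set.ofPred_forall]
    exact isClosed_iInter fun v => isClosed_le continuous_const (by fun_prop)
  have hmeas : Measurable fun s (i : Fin d) (j : Fin n) => M s i j :=
    measurable_pi_lambda _ fun i => measurable_pi_lambda _ fun j => hM i j
  convert hmeas hclosed.measurableSet using 1
  ext s
  simp only [Set.mem_ofPred_eq, Set.mem_preimage, le_sq_minSingularValue_iff hn]
  rfl

end Measurability

lemma orthogonalityGap_nonneg {d n : ℕ} (H : Matrix (Fin d) (Fin n) ℝ) :
    0 ≤ orthogonalityGap H :=
  frobNorm_nonneg _

section Past

variable {d n : ℕ}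

/-- The sequence of weight matrices with the given entries. -/
def weightsOfEntries (z : ℕ × Fin d × Fin d → ℝ) (k : ℕ) : Matrix (Fin d) (Fin d) ℝ :=
  Matrix.of fun i j => z (k, i, j)

/-- The entries of the first `l` weight matrices, all others being replaced by zero. -/
def pastEntries (l : ℕ) (z : ℕ × Fin d × Fin d → ℝ) : ℕ × Fin d × Fin d → ℝ :=
  fun p => if p.1 < l then z p else 0

lemma hiddenRep_congr (H₀ : Matrix (Fin d) (Fin n) ℝ) {W W' : ℕ → Matrix (Fin d) (Fin d) ℝ}
    {k : ℕ} (h : ∀ m < k, W m = W' m) : hiddenRep H₀ W k = hiddenRep H₀ W' k := by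
  induction k with
  | zero => rfl
  | succ k ih =>
    rw [hiddenRep, hiddenRep, h k (Nat.lt_succ_self k), ih fun m hm => h m (hm.trans k.lt_succ_self)]

lemma hiddenRep_pastEntries (H₀ : Matrix (Fin d) (Fin n) ℝ) (z : ℕ × Fin d × Fin d → ℝ)
    {k l : ℕ} (hkl : k ≤ l) :
    hiddenRep H₀ (weightsOfEntries (pastEntries l z)) k = hiddenRep H₀ (weightsOfEntries z) k := by
  refine hiddenRep_congr H₀ fun m hm => ?_
  ext i j
  simp [weightsOfEntries, pastEntries, hm.trans_le hkl]

lemma measurable_hiddenRep_weightsOfEntries (H₀ : Matrix (Fin d) (Fin n) ℝ) (k : ℕ)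
    (i : Fin d) (j : Fin n) :
    Measurable fun z => hiddenRep H₀ (weightsOfEntries z) k i j :=
  measurable_hiddenRep_apply H₀ (fun _ _ _ => measurable_pi_apply _) k i j

lemma frobNorm_sq_hiddenRep_succ_le_one (H₀ : Matrix (Fin d) (Fin n) ℝ)
    (W : ℕ → Matrix (Fin d) (Fin d) ℝ) (k : ℕ) : frobNorm (hiddenRep H₀ W (k + 1)) ^ 2 ≤ 1 :=
  frobNorm_sq_smul_batchNorm_le_one _

lemma sq_minSingularValue_le_frobNorm_sq (hn : 0 < n) (H : Matrix (Fin d) (Fin n) ℝ) :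
    minSingularValue H ^ 2 ≤ frobNorm H ^ 2 := by
  have h := (le_sq_minSingularValue_iff hn H _).1 le_rfl (Pi.single ⟨0, hn⟩ 1)
  rw [frobNorm_sq]
  simp only [Matrix.mulVec_single_one, Matrix.col_apply] at h
  rw [Finset.sum_eq_single ⟨0, hn⟩ (fun j _ hj => by simp [hj]) (by simp)] at h
  simp only [Pi.single_eq_same, one_pow, mul_one] at h
  exact h.trans (Finset.sum_le_sum fun i _ =>
    Finset.single_le_sum (f := fun j => H i j ^ 2) (fun _ _ => sq_nonneg _) (Finset.mem_univ _))

end Past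

lemma integral_comp_eq_integral_integral_of_indepFun {Ω S T : Type*} [MeasurableSpace Ω]
    [MeasurableSpace S] [MeasurableSpace T] {P : Measure Ω} [IsProbabilityMeasure P]
    {Y : Ω → S} {Z : Ω → T} (hY : AEMeasurable Y P) (hZ : AEMeasurable Z P)
    (hind : IndepFun Y Z P) {F : S → T → ℝ} (hF : Measurable (Function.uncurry F)) {C : ℝ}
    (hC : ∀ y z, ‖F y z‖ ≤ C) :
    ∫ ω, F (Y ω) (Z ω) ∂P = ∫ ω', ∫ ω, F (Y ω) (Z ω') ∂P ∂P := by
  have hpY := Measure.isProbabilityMeasure_map hY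
  have hpZ := Measure.isProbabilityMeasure_map hZ
  have hint : Integrable (Function.uncurry F) ((P.map Y).prod (P.map Z)) :=
    Integrable.of_bound hF.aestronglyMeasurable C (Filter.Eventually.of_forall fun p => hC p.1 p.2)
  have h1 : ∫ ω, F (Y ω) (Z ω) ∂P
      = ∫ p, Function.uncurry F p ∂P.map (fun ω => (Y ω, Z ω)) := by
    rw [integral_map (hY.prodMk hZ) hF.aestronglyMeasurable]
    rfl
  rw [h1, hind.map_prod_eq_prod_map_map hY hZ, integral_prod_symm _ hint,
    integral_map hZ hint.integral_prod_right.aestronglyMeasurable]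
  refine integral_congr_ae (Filter.Eventually.of_forall fun ω' => ?_)
  exact integral_map hY (hF.comp (measurable_id.prodMk measurable_const)).aestronglyMeasurable

section Weights

variable {Ω : Type*} [MeasurableSpace Ω] {P : Measure Ω} {d n : ℕ}
  {W : ℕ → Ω → Matrix (Fin d) (Fin d) ℝ}

/-- All entries of all the weight matrices. -/
def allEntries {Ω : Type*} (W : ℕ → Ω → Matrix (Fin d) (Fin d) ℝ) (ω : Ω) : ℕ × Fin d × Fin d → ℝ :=
  fun p => W p.1 ω p.2.1 p.2.2

lemma weightsOfEntries_allEntries {Ω : Type*} (W : ℕ → Ω → Matrix (Fin d) (Fin d) ℝ) (ω : Ω) :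
    weightsOfEntries (allEntries W ω) = fun k => W k ω := rfl

lemma IsGaussianWeights.aemeasurable_entry (hW : IsGaussianWeights P W)
    (p : ℕ × Fin d × Fin d) : AEMeasurable (fun ω => W p.1 ω p.2.1 p.2.2) P :=
  (hW.hasLaw p.1 p.2.1 p.2.2).aemeasurable

lemma IsGaussianWeights.aemeasurable_allEntries (hW : IsGaussianWeights P W) :
    AEMeasurable (allEntries W) P :=
  aemeasurable_pi_lambda _ hW.aemeasurable_entry

lemma IsGaussianWeights.iIndepFun_layer (hW : IsGaussianWeights P W) (l : ℕ) :
    iIndepFun (fun (p : Fin d × Fin d) ω => W l ω p.1 p.2) P :=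
  hW.indep.precomp (g := fun p : Fin d × Fin d => (l, p)) (Prod.mk_right_injective l)

/-- Zeroing the entries of layers ≥ l makes the past a function of a finite set of entries, disjoint
from those of layer l. -/
lemma IsGaussianWeights.indepFun_layer_past (hW : IsGaussianWeights P W) (l : ℕ) :
    IndepFun (fun ω (p : Fin d × Fin d) => W l ω p.1 p.2)
      (fun ω => pastEntries l (allEntries W ω)) P := by
  let S : Finset (ℕ × Fin d × Fin d) := {l} ×ˢ Finset.univ
  let T : Finset (ℕ × Fin d × Fin d) := Finset.range l ×ˢ Finset.univ
  have hST : Disjoint S T := by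
    rw [Finset.disjoint_left]
    intro p hp hp'
    simp only [S, T, Finset.mem_product, Finset.mem_singleton, Finset.mem_range] at hp hp'
    omega
  have h := hW.indep.indepFun_finset₀ S T hST hW.aemeasurable_entry
  let φ : (S → ℝ) → (Fin d × Fin d → ℝ) := fun y p => y ⟨(l, p), by simp [S]⟩
  let ψ : (T → ℝ) → (ℕ × Fin d × Fin d → ℝ) := fun y p =>
    if hp : p.1 < l then y ⟨p, by simp [T, hp]⟩ else 0
  have hφ : Measurable φ := measurable_pi_lambda _ fun p => measurable_pi_apply _
  have hψ : Measurable ψ := by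
    refine measurable_pi_lambda _ fun p => ?_
    by_cases hp : p.1 < l
    · simp only [ψ, hp, dif_pos]
      exact measurable_pi_apply _
    · simp only [ψ, hp, dif_neg, not_false_eq_true]
      exact measurable_const
  have hψ' : (fun ω => pastEntries l (allEntries W ω))
      = ψ ∘ fun ω (p : T) => W p.1.1 ω p.1.2.1 p.1.2.2 := by
    funext ω p
    simp only [ψ, Function.comp, pastEntries, allEntries]
    split_ifs <;> rfl
  rw [hψ']
  exact h.comp hφ hψ

lemma IsGaussianWeights.aemeasurable_orthogonalityGap (hW : IsGaussianWeights P W)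
    (H₀ : Matrix (Fin d) (Fin n) ℝ) (k : ℕ) :
    AEMeasurable (fun ω => orthogonalityGap (hiddenRep H₀ (fun k => W k ω) k)) P := by
  have h := measurable_orthogonalityGap (M := fun z => hiddenRep H₀ (weightsOfEntries z) k)
    (measurable_hiddenRep_weightsOfEntries H₀ k)
  have h' := h.comp_aemeasurable hW.aemeasurable_allEntries
  simpa only [Function.comp_def, weightsOfEntries_allEntries] using h'

lemma IsGaussianWeights.integrable_orthogonalityGap [IsProbabilityMeasure P]
    (hW : IsGaussianWeights P W)
    (H₀ : Matrix (Fin d) (Fin n) ℝ) (k : ℕ) :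
    Integrable (fun ω => orthogonalityGap (hiddenRep H₀ (fun k => W k ω) k)) P :=
  Integrable.of_bound (hW.aemeasurable_orthogonalityGap H₀ k).aestronglyMeasurable 1
    (Filter.Eventually.of_forall fun ω => by
      rw [Real.norm_of_nonneg (orthogonalityGap_nonneg _)]
      exact orthogonalityGap_le_one _)

/-- Conditioning on the first `l` weight matrices. -/
lemma IsGaussianWeights.setIntegral_orthogonalityGap_succ [IsProbabilityMeasure P]
    (hW : IsGaussianWeights P W)
    (H₀ : Matrix (Fin d) (Fin n) ℝ) (l : ℕ) {B : Set (ℕ × Fin d × Fin d → ℝ)}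
    (hB : MeasurableSet B) (hBpast : ∀ z, pastEntries l z ∈ B ↔ z ∈ B) :
    ∫ ω in {ω | allEntries W ω ∈ B}, orthogonalityGap (hiddenRep H₀ (fun k => W k ω) (l + 1)) ∂P
      = ∫ ω' in {ω | allEntries W ω ∈ B}, ∫ ω, orthogonalityGap ((1 / Real.sqrt d) •
          batchNorm (W l ω * hiddenRep H₀ (fun k => W k ω') l)) ∂P ∂P := by
  classical
  -- The entries are only known to be almost everywhere measurable, so the event is handled as a
  -- null-measurable set.
  have hBW : NullMeasurableSet {ω | allEntries W ω ∈ B} P :=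
    hW.aemeasurable_allEntries.nullMeasurableSet_preimage hB
  let V : (Fin d × Fin d → ℝ) → (ℕ × Fin d × Fin d → ℝ) → ℝ := fun y z =>
    orthogonalityGap ((1 / Real.sqrt d) •
      batchNorm ((Matrix.of fun i j => y (i, j)) * hiddenRep H₀ (weightsOfEntries z) l))
  -- The indicator depends on the past variable alone, so the restriction to the event survives the
  -- inner integration over the new layer.
  let F : (Fin d × Fin d → ℝ) → (ℕ × Fin d × Fin d → ℝ) → ℝ := fun y z => B.indicator (V y) z
  have hV : Measurable (Function.uncurry V) := by
    have h1 : ∀ i j, Measurable fun p : (Fin d × Fin d → ℝ) × (ℕ × Fin d × Fin d → ℝ) =>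
        (Matrix.of fun i j => p.1 (i, j) : Matrix (Fin d) (Fin d) ℝ) i j :=
      fun i j => (measurable_pi_apply (i, j)).comp measurable_fst
    have h2 : ∀ i j, Measurable fun p : (Fin d × Fin d → ℝ) × (ℕ × Fin d × Fin d → ℝ) =>
        hiddenRep H₀ (weightsOfEntries p.2) l i j :=
      fun i j => (measurable_hiddenRep_weightsOfEntries H₀ l i j).comp measurable_snd
    exact measurable_orthogonalityGap (measurable_batchNorm_apply (measurable_mul_apply h1 h2))
  have hF : Measurable (Function.uncurry F) := by
    have : Function.uncurry F = (Prod.snd ⁻¹' B).indicator (Function.uncurry V) := by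
      funext p
      simp only [F, Function.uncurry, Set.indicator, Set.mem_preimage]
    rw [this]
    exact hV.indicator (measurable_snd hB)
  have hC : ∀ y z, ‖F y z‖ ≤ 1 := by
    intro y z
    simp only [F, Set.indicator]
    split_ifs
    · rw [Real.norm_of_nonneg (orthogonalityGap_nonneg _)]
      exact orthogonalityGap_le_one _
    · simp
  have hpast : Measurable (pastEntries (d := d) l) := by
    refine measurable_pi_lambda _ fun p => ?_
    by_cases hp : p.1 < l
    · simp only [pastEntries, hp, if_true]
      exact measurable_pi_apply _
    · simp only [pastEntries, hp, if_false]
      exact measurable_const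
  have key := integral_comp_eq_integral_integral_of_indepFun
    (aemeasurable_pi_lambda _ fun p => (hW.hasLaw l p.1 p.2).aemeasurable)
    (hpast.comp_aemeasurable hW.aemeasurable_allEntries) (hW.indepFun_layer_past l) hF hC
  have hFval : ∀ ω ω', F (fun p => W l ω p.1 p.2) (pastEntries l (allEntries W ω'))
      = {ω | allEntries W ω ∈ B}.indicator (fun ω' => orthogonalityGap ((1 / Real.sqrt d) •
          batchNorm (W l ω * hiddenRep H₀ (fun k => W k ω') l))) ω' := by
    intro ω ω'
    simp only [F, V, Set.indicator, hBpast, Set.mem_ofPred_eq, hiddenRep_pastEntries H₀ _ le_rfl,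
      weightsOfEntries_allEntries]
    rfl
  have hsucc : ∀ ω, hiddenRep H₀ (fun k => W k ω) (l + 1)
      = (1 / Real.sqrt d) • batchNorm (W l ω * hiddenRep H₀ (fun k => W k ω) l) := fun _ => rfl
  rw [← integral_indicator₀ hBW, ← integral_indicator₀ hBW]
  simp only [Function.comp_apply, hFval] at key
  simp only [hsucc]
  simp only [Set.indicator] at key ⊢
  rw [key]
  refine integral_congr_ae (Filter.Eventually.of_forall fun ω' => ?_)
  dsimp only
  split_ifs <;> simp

end Weights

/-! ### Recursion over the layers -/

section Recursion

variable {Ω : Type*} [MeasurableSpace Ω] {P : Measure Ω} [IsProbabilityMeasure P] {d n : ℕ}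
  {W : ℕ → Ω → Matrix (Fin d) (Fin d) ℝ}

lemma integral_orthogonalityGap_le_one (hW : IsGaussianWeights P W)
    (H₀ : Matrix (Fin d) (Fin n) ℝ) (k : ℕ) (s : Set Ω) :
    ∫ ω in s, orthogonalityGap (hiddenRep H₀ (fun k => W k ω) k) ∂P ≤ 1 := by
  calc _ ≤ ∫ ω, orthogonalityGap (hiddenRep H₀ (fun k => W k ω) k) ∂P :=
        setIntegral_le_integral (hW.integrable_orthogonalityGap H₀ k)
          (Filter.Eventually.of_forall fun _ => orthogonalityGap_nonneg _)
    _ ≤ ∫ _, 1 ∂P := integral_mono (hW.integrable_orthogonalityGap H₀ k) (integrable_const _)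
          fun _ => orthogonalityGap_le_one _
    _ = 1 := by simp

/-- The weights for which all the representations `H_1, …, H_l` have squared singular values at
least `a`. -/
def wellConditioned (H₀ : Matrix (Fin d) (Fin n) ℝ) (a : ℝ) (l : ℕ) :
    Set (ℕ × Fin d × Fin d → ℝ) :=
  {z | ∀ k : ℕ, 1 ≤ k → k ≤ l → a ≤ minSingularValue (hiddenRep H₀ (weightsOfEntries z) k) ^ 2}

lemma measurableSet_wellConditioned (hn : 0 < n) (H₀ : Matrix (Fin d) (Fin n) ℝ) (a : ℝ) (l : ℕ) :
    MeasurableSet (wellConditioned H₀ a l) := by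
  have : wellConditioned H₀ a l = ⋂ k : ℕ, ⋂ _ : 1 ≤ k, ⋂ _ : k ≤ l,
      {z | a ≤ minSingularValue (hiddenRep H₀ (weightsOfEntries z) k) ^ 2} := by
    ext z
    simp [wellConditioned]
  rw [this]
  exact MeasurableSet.iInter fun k => MeasurableSet.iInter fun _ => MeasurableSet.iInter fun _ =>
    measurableSet_le_sq_minSingularValue hn (measurable_hiddenRep_weightsOfEntries H₀ k) a

lemma pastEntries_mem_wellConditioned (H₀ : Matrix (Fin d) (Fin n) ℝ) (a : ℝ) (l : ℕ)
    (z : ℕ × Fin d × Fin d → ℝ) :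
    pastEntries l z ∈ wellConditioned H₀ a l ↔ z ∈ wellConditioned H₀ a l := by
  refine forall_congr' fun k => forall_congr' fun _ => forall_congr' fun hk => ?_
  rw [hiddenRep_pastEntries H₀ z hk]

lemma setIntegral_wellConditioned_succ_le (hn : 0 < n) (hd : 0 < d)
    (hW : IsGaussianWeights P W) (H₀ : Matrix (Fin d) (Fin n) ℝ) {a : ℝ} (ha : 0 < a)
    (ha1 : a ≤ 1) (l : ℕ) :
    ∫ ω in {ω | allEntries W ω ∈ wellConditioned H₀ a (l + 1)},
        orthogonalityGap (hiddenRep H₀ (fun k => W k ω) (l + 1 + 1)) ∂P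
      ≤ (1 - 2 / 3 * a) * ∫ ω in {ω | allEntries W ω ∈ wellConditioned H₀ a l},
        orthogonalityGap (hiddenRep H₀ (fun k => W k ω) (l + 1)) ∂P + 1 / Real.sqrt d := by
  rw [hW.setIntegral_orthogonalityGap_succ H₀ (l + 1) (measurableSet_wellConditioned hn H₀ a (l + 1))
    (pastEntries_mem_wellConditioned H₀ a (l + 1))]
  have hnull : NullMeasurableSet {ω | allEntries W ω ∈ wellConditioned H₀ a (l + 1)} P :=
    hW.aemeasurable_allEntries.nullMeasurableSet_preimage
      (measurableSet_wellConditioned hn H₀ a (l + 1))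
  have hgap := hW.integrable_orthogonalityGap H₀ (l + 1)
  -- The events decrease and V ≥ 0, so the gap of the previous layer may be integrated over the
  -- larger event, where the induction applies.
  have hsub : {ω | allEntries W ω ∈ wellConditioned H₀ a (l + 1)}
      ⊆ {ω | allEntries W ω ∈ wellConditioned H₀ a l} :=
    fun ω hω k hk hkl => hω k hk (hkl.trans l.le_succ)
  calc _ ≤ ∫ ω in {ω | allEntries W ω ∈ wellConditioned H₀ a (l + 1)},
        ((1 - 2 / 3 * a) * orthogonalityGap (hiddenRep H₀ (fun k => W k ω) (l + 1))
          + 1 / Real.sqrt d) ∂P := by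
        refine integral_mono_of_nonneg
          (Filter.Eventually.of_forall fun _ => integral_nonneg fun _ => orthogonalityGap_nonneg _)
          ((hgap.const_mul _).add (integrable_const _)).integrableOn ?_
        filter_upwards [ae_restrict_mem₀ hnull] with ω hω
        exact integral_orthogonalityGap_layer_le hn hd (hW.hasLaw (l + 1))
          (hW.iIndepFun_layer (l + 1)) ha (hω (l + 1) (by omega) le_rfl)
          (frobNorm_sq_hiddenRep_succ_le_one H₀ (fun k => W k ω) l)
    _ = (1 - 2 / 3 * a) * ∫ ω in {ω | allEntries W ω ∈ wellConditioned H₀ a (l + 1)},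
          orthogonalityGap (hiddenRep H₀ (fun k => W k ω) (l + 1)) ∂P
        + P.real {ω | allEntries W ω ∈ wellConditioned H₀ a (l + 1)} * (1 / Real.sqrt d) := by
        rw [integral_add (hgap.const_mul _).integrableOn (integrable_const _), integral_const_mul,
          setIntegral_const, smul_eq_mul]
    _ ≤ _ := by
        refine add_le_add (mul_le_mul_of_nonneg_left ?_ (by linarith)) ?_
        · exact setIntegral_mono_set hgap.integrableOn
            (Filter.Eventually.of_forall fun _ => orthogonalityGap_nonneg _) hsub.eventuallyLE
        · exact mul_le_of_le_one_left (by positivity) measureReal_le_one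

/-- The constant 3/(2a√d) is the fixed point of x ↦ (1 - 2a/3)x + 1/√d. -/
lemma setIntegral_wellConditioned_le (hn : 0 < n) (hd : 0 < d)
    (hW : IsGaussianWeights P W) (H₀ : Matrix (Fin d) (Fin n) ℝ) {a : ℝ} (ha : 0 < a)
    (ha1 : a ≤ 1) (l : ℕ) :
    ∫ ω in {ω | allEntries W ω ∈ wellConditioned H₀ a l},
        orthogonalityGap (hiddenRep H₀ (fun k => W k ω) (l + 1)) ∂P
      ≤ (1 - 2 / 3 * a) ^ l + 3 / 2 / (a * Real.sqrt d) := by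
  have hs : 0 < Real.sqrt d := Real.sqrt_pos.2 (by exact_mod_cast hd)
  induction l with
  | zero =>
    refine (integral_orthogonalityGap_le_one hW H₀ _ _).trans ?_
    have : 0 < 3 / 2 / (a * Real.sqrt d) := by positivity
    simp [this.le]
  | succ l ih =>
    refine (setIntegral_wellConditioned_succ_le hn hd hW H₀ ha ha1 l).trans ?_
    have h := mul_le_mul_of_nonneg_left ih (show 0 ≤ 1 - 2 / 3 * a by linarith)
    have e : (1 - 2 / 3 * a) * ((1 - 2 / 3 * a) ^ l + 3 / 2 / (a * Real.sqrt d)) + 1 / Real.sqrt d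
        = (1 - 2 / 3 * a) ^ (l + 1) + 3 / 2 / (a * Real.sqrt d) := by
      field_simp
      ring
    linarith

/-- With a single sample, the expected orthogonality gap vanishes after a nonzero
representation. -/
lemma integral_orthogonalityGap_eq_zero_of_single (hd : 0 < d) (hW : IsGaussianWeights P W)
    (H₀ : Matrix (Fin d) (Fin 1) ℝ) (l : ℕ)
    (h : ∀ᵐ ω ∂P, 0 < frobNorm (hiddenRep H₀ (fun k => W k ω) l) ^ 2) :
    ∫ ω, orthogonalityGap (hiddenRep H₀ (fun k => W k ω) (l + 1)) ∂P = 0 := by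
  have key := hW.setIntegral_orthogonalityGap_succ H₀ l (B := Set.univ) MeasurableSet.univ (by simp)
  simp only [Set.mem_univ, Set.ofPred_true, Measure.restrict_univ] at key
  rw [key]
  refine integral_eq_zero_of_ae ?_
  filter_upwards [h] with ω hω
  exact integral_eq_zero_of_ae
    (ae_orthogonalityGap_layer_eq_zero hd (hW.hasLaw l) (hW.iIndepFun_layer l) hω)

end Recursion

/-! ### Failure of an almost sure lower bound for two or more samples -/

section Degeneracy

lemma isOpenPosMeasure_gaussianReal (m : ℝ) {v : ℝ≥0} (hv : v ≠ 0) :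
    (gaussianReal m v).IsOpenPosMeasure :=
  (gaussianReal_absolutelyContinuous' m hv).isOpenPosMeasure

lemma exists_ne_zero_orthogonal {n : ℕ} (hn : 2 ≤ n) (r : Fin n → ℝ) :
    ∃ v : Fin n → ℝ, v ≠ 0 ∧ ∑ j, r j * v j = 0 := by
  let L : (Fin n → ℝ) →ₗ[ℝ] ℝ := dotProductBilin ℝ ℝ r
  have h : LinearMap.ker L ≠ ⊥ := L.ker_ne_bot_of_finrank_lt (by simp; omega)
  obtain ⟨v, hv, hv0⟩ := (Submodule.ne_bot_iff _).1 h
  exact ⟨v, hv0, hv⟩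

/-- For at least two samples the smallest singular value after a Gaussian layer is not almost
surely bounded away from zero. -/
lemma not_ae_le_minSingularValue_layer {Ω : Type*} [MeasurableSpace Ω] {P : Measure Ω}
    [IsProbabilityMeasure P] {d n : ℕ} (hn : 2 ≤ n) (hd : 0 < d)
    {A : Ω → Matrix (Fin d) (Fin d) ℝ}
    (hA : ∀ i j, HasLaw (fun ω => A ω i j) (gaussianReal 0 ((d : ℝ≥0)⁻¹)) P)
    (hind : iIndepFun (fun (p : Fin d × Fin d) ω => A ω p.1 p.2) P)
    {H : Matrix (Fin d) (Fin n) ℝ} (hH : H ≠ 0) {a : ℝ} (ha : 0 < a) :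
    ¬ ∀ᵐ ω ∂P, a ≤ minSingularValue ((1 / Real.sqrt d) • batchNorm (A ω * H)) := by
  intro hae
  obtain ⟨i₀, j₀, hij⟩ : ∃ i j, H i j ≠ 0 := by
    by_contra! h
    exact hH (Matrix.ext h)
  obtain ⟨v, hv0, hv⟩ := exists_ne_zero_orthogonal hn (H i₀)
  -- The squared norm of the next representation applied to v, as a function of the weights. The
  -- assumed bound keeps it above a²‖v‖² almost surely.
  let g : (Fin d × Fin d → ℝ) → ℝ := fun x =>
    ∑ i, (((1 / Real.sqrt d) • batchNorm ((Matrix.of fun i j => x (i, j)) * H)).mulVec v) i ^ 2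
  have hg : ∀ x, g x = ∑ i, (∑ j, (1 / Real.sqrt d *
      ((Real.sqrt (∑ k, (∑ m, x (i, m) * H m k) ^ 2))⁻¹ * ∑ m, x (i, m) * H m j)) * v j) ^ 2 := by
    intro x
    simp only [g, Matrix.mulVec, dotProduct, Matrix.smul_apply, batchNorm_apply, smul_eq_mul,
      Matrix.mul_apply, Matrix.of_apply]
  have hgm : Measurable g := by
    simp only [funext hg]
    fun_prop
  have hvpos : 0 < ∑ j, v j ^ 2 := by
    obtain ⟨j, hj⟩ := Function.ne_iff.1 hv0
    have : v j ≠ 0 := hj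
    exact (by positivity : 0 < v j ^ 2).trans_le
      (Finset.single_le_sum (f := fun j => v j ^ 2) (fun _ _ => sq_nonneg _) (Finset.mem_univ j))
  have hlaw := iIndepFun.hasLaw_pi (X := fun (p : Fin d × Fin d) ω => A ω p.1 p.2)
    (fun p => hA p.1 p.2) hind
  have hlow : ∀ᵐ x ∂Measure.pi fun _ : Fin d × Fin d => gaussianReal 0 ((d : ℝ≥0)⁻¹),
      a ^ 2 * ∑ j, v j ^ 2 ≤ g x := by
    rw [← hlaw.map_eq, ae_map_iff hlaw.aemeasurable (measurableSet_le measurable_const hgm)]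
    filter_upwards [hae] with ω hω
    exact (le_sq_minSingularValue_iff (by omega) _ _).1 (pow_le_pow_left₀ ha.le hω 2) v
  have hv' : (d : ℝ≥0)⁻¹ ≠ 0 := inv_ne_zero (by exact_mod_cast hd.ne')
  have := isOpenPosMeasure_gaussianReal 0 hv'
  -- With these weights every row of the product equals the nonzero row i₀ of H, to which v is
  -- orthogonal, so g vanishes.
  let x₀ : Fin d × Fin d → ℝ := fun p => if p.2 = i₀ then 1 else 0
  have hrow : ∀ i k, ∑ m, x₀ (i, m) * H m k = H i₀ k := fun i k => by simp [x₀]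
  have hnorm : 0 < ∑ k, H i₀ k ^ 2 :=
    (by positivity : 0 < H i₀ j₀ ^ 2).trans_le
      (Finset.single_le_sum (f := fun k => H i₀ k ^ 2) (fun _ _ => sq_nonneg _)
        (Finset.mem_univ j₀))
  have hg0 : g x₀ = 0 := by
    rw [hg]
    refine Finset.sum_eq_zero fun i _ => ?_
    simp only [hrow, mul_assoc, ← Finset.mul_sum, hv]
    simp
  -- Row normalization can jump at a zero row; no row vanishes at x₀, so continuity holds there.
  have hcont : ContinuousAt g x₀ := by
    simp only [funext hg]
    refine tendsto_finsetSum _ fun i _ => ContinuousAt.pow ?_ 2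
    refine tendsto_finsetSum _ fun j _ => ContinuousAt.mul (ContinuousAt.mul continuousAt_const
      (ContinuousAt.mul (ContinuousAt.inv₀ (Continuous.continuousAt (by fun_prop)) ?_)
        (Continuous.continuousAt (by fun_prop)))) continuousAt_const
    simp only [hrow]
    exact (Real.sqrt_pos.2 hnorm).ne'
  have hnear : ∀ᶠ x in nhds x₀, g x < a ^ 2 * ∑ j, v j ^ 2 := by
    refine hcont.eventually_lt_const ?_
    rw [hg0]
    positivity
  have hpos := Measure.measure_pos_of_mem_nhds
    (Measure.pi fun _ : Fin d × Fin d => gaussianReal 0 ((d : ℝ≥0)⁻¹)) hnear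
  refine hpos.ne' (measure_mono_null (fun x hx => ?_) (ae_iff.1 hlow))
  exact not_le.2 hx

end Degeneracy

/-! ### The main theorem -/

theorem theorem1 {Ω : Type*} [MeasurableSpace Ω] (P : Measure Ω) [IsProbabilityMeasure P]
    {d n : ℕ} (hn : 1 ≤ n) (hnd : n ≤ d)
    (H₀ : Matrix (Fin d) (Fin n) ℝ) (hH₀ : H₀ ≠ 0)
    (W : ℕ → Ω → Matrix (Fin d) (Fin d) ℝ) (hW : IsGaussianWeights P W)
    (l : ℕ) (α : ℝ) (hα : 0 < α) :
    Integrable (fun ω => orthogonalityGap (hiddenRep H₀ (fun k => W k ω) (l + 1))) P ∧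
    -- the minimum singular values are almost surely at least `α`
    ((∀ᵐ ω ∂P, ∀ k : ℕ, 1 ≤ k → k ≤ l →
        α ≤ minSingularValue (hiddenRep H₀ (fun k => W k ω) k)) →
      ∫ ω, orthogonalityGap (hiddenRep H₀ (fun k => W k ω) (l + 1)) ∂P
        ≤ 2 * (1 - 2 / 3 * α) ^ l + 3 * n / (α * Real.sqrt d)) ∧
    -- no almost sure assumption: the expectation runs over the event that the
    -- squared minimum singular values are at least `α`
    (α ≤ 1 →
      ∫ ω in {ω | ∀ k : ℕ, 1 ≤ k → k ≤ l →
          α ≤ minSingularValue (hiddenRep H₀ (fun k => W k ω) k) ^ 2},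
        orthogonalityGap (hiddenRep H₀ (fun k => W k ω) (l + 1)) ∂P
        ≤ 2 * (1 - 2 / 3 * α) ^ l + 3 * n / (α * Real.sqrt d)) := by
  have hd : 0 < d := by omega
  have hs : 0 < Real.sqrt d := Real.sqrt_pos.2 (by exact_mod_cast hd)
  have hnR : (1 : ℝ) ≤ n := by exact_mod_cast hn
  have herr : 0 ≤ 3 * n / (α * Real.sqrt d) := by positivity
  refine ⟨hW.integrable_orthogonalityGap H₀ (l + 1), fun hae => ?_, fun hα1 => ?_⟩
  · rcases Nat.eq_zero_or_pos l with rfl | hl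
    · have h := integral_orthogonalityGap_le_one hW H₀ (0 + 1) Set.univ
      rw [Measure.restrict_univ] at h
      rw [pow_zero]
      linarith
    rcases Nat.lt_or_ge n 2 with hn2 | hn2
    · obtain rfl : n = 1 := by omega
      have hlast : ∀ᵐ ω ∂P, α ^ 2 ≤ frobNorm (hiddenRep H₀ (fun k => W k ω) l) ^ 2 := by
        filter_upwards [hae] with ω hω
        exact (pow_le_pow_left₀ hα.le (hω l hl le_rfl) 2).trans
          (sq_minSingularValue_le_frobNorm_sq one_pos _)
      -- The expected gap is 0 here, but α ≤ 1 is still needed to make the power (1 - 2α/3)^l on the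
      -- right nonnegative.
      have hα1 : α ≤ 1 := by
        obtain ⟨ω, hω⟩ := hlast.exists
        obtain ⟨m, rfl⟩ := Nat.exists_eq_succ_of_ne_zero hl.ne'
        have := hω.trans (frobNorm_sq_hiddenRep_succ_le_one H₀ (fun k => W k ω) m)
        exact (sq_le_one_iff₀ hα.le).1 this
      rw [integral_orthogonalityGap_eq_zero_of_single hd hW H₀ l (by
        filter_upwards [hlast] with ω hω
        exact lt_of_lt_of_le (by positivity) hω)]
      have : 0 ≤ (1 - 2 / 3 * α) ^ l := pow_nonneg (by linarith) l
      linarith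
    · refine absurd ?_ (not_ae_le_minSingularValue_layer hn2 hd (hW.hasLaw 0)
        (hW.iIndepFun_layer 0) hH₀ hα)
      filter_upwards [hae] with ω hω
      exact hω 1 le_rfl hl
  · refine (setIntegral_wellConditioned_le hn hd hW H₀ hα hα1 l).trans ?_
    have h1 : 0 ≤ (1 - 2 / 3 * α) ^ l := pow_nonneg (by linarith) l
    have h2 : 3 / 2 / (α * Real.sqrt d) ≤ 3 * n / (α * Real.sqrt d) := by
      gcongr
      linarith
    linarith
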